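/- Let $N\ge 1$, let $\Omega\subset\mathbb{R}^N$ be a nonempty bounded open set (connectedness is not required), let $1<p<\infty$ and $\ell\in\{0,\infty\}$, and let $f\colon\mathbb{R}\to\mathbb{R}$ be continuous with $f(0)\ge 0$. Put $F(s)=\int_0^s f(t)\,\mathrm{d}t$ for $s\ge 0$. Suppose that there is a sequence $\{\alpha_n\}\subset(0,\infty)$ with $\alpha_n\to\ell$ and $f(\alpha_n)=0$ for all $n$, and that $$-\infty<\liminf_{s\to\ell}\frac{F(s)}{s^p}\le\limsup_{s\to\ell}\frac{F(s)}{s^p}=L^+\in(0,\infty],$$ where the limits are taken as $s\to0^+$ if $\ell=0$ and as $s\to\infty$ if $\ell=\infty$. Then there exists $\overline{\lambda}\in[0,\infty)$ such that, for every $\lambda>\overline{\lambda}$, the problem $$-\operatorname{div}\left(|\nabla u|^{p-2}\nabla u\right)=\lambda f(u)\ \text{ in }\Omega,\qquad u=0\ \text{ on }\partial\Omega,$$ has a sequence $\{u_n\}$ of bounded weak solutions such that $u_n\ge0$ almost everywhere in $\Omega$, $u_n$ is not almost everywhere zero in $\Omega$, and $\|u_n\|_{L^\infty(\Omega)}\to\ell$.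 Furthermore, if $L^+=\infty$, then one can take $\overline{\lambda}=0$. Here a bounded weak solution is a function $u\in W^{1,p}_0(\Omega)\cap L^\infty(\Omega)$ with $\int_\Omega|\nabla u|^{p-2}\nabla u\cdot\nabla\varphi\,\mathrm{d}x=\lambda\int_\Omega f(u)\varphi\,\mathrm{d}x$ for all $\varphi\in C_c^\infty(\Omega)$, where $W^{1,p}_0(\Omega)$ is the closure of $C_c^\infty(\Omega)$ in $W^{1,p}(\Omega)$. -/

import Mathlib

open Set Filter Topology MeasureTheory
open scoped ENNReal ContDiff

noncomputable section

/-- `φ` is a test function on `Ω`, i.e. `φ ∈ C_c^∞(Ω)`. -/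
structure IsTestFunction {N : ℕ} (Ω : Set (EuclideanSpace ℝ (Fin N)))
    (φ : EuclideanSpace ℝ (Fin N) → ℝ) : Prop where
  contDiff : ContDiff ℝ ∞ φ
  hasCompactSupport : HasCompactSupport φ
  tsupport_subset : tsupport φ ⊆ Ω

/-- `G` is the weak gradient of `u` on the open set `Ω`: both are locally integrable and
`∫_Ω u ∂_v φ = - ∫_Ω φ ⟨G, v⟩` for all test functions `φ` and all directions `v`. -/
structure HasWeakGradient {N : ℕ} (Ω : Set (EuclideanSpace ℝ (Fin N)))
    (u : EuclideanSpace ℝ (Fin N) → ℝ)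
    (G : EuclideanSpace ℝ (Fin N) → EuclideanSpace ℝ (Fin N)) : Prop where
  locallyIntegrableOn : LocallyIntegrableOn u Ω volume
  locallyIntegrableOn_grad : LocallyIntegrableOn G Ω volume
  integral_eq : ∀ φ : EuclideanSpace ℝ (Fin N) → ℝ, IsTestFunction Ω φ →
    ∀ v : EuclideanSpace ℝ (Fin N),
      ∫ x in Ω, u x * fderiv ℝ φ x v = - ∫ x in Ω, φ x * inner ℝ (G x) v

/-- `u ∈ W^{1,p}(Ω)` with weak gradient `G`. -/
structure MemSobolev {N : ℕ} (p : ℝ) (Ω : Set (EuclideanSpace ℝ (Fin N)))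
    (u : EuclideanSpace ℝ (Fin N) → ℝ)
    (G : EuclideanSpace ℝ (Fin N) → EuclideanSpace ℝ (Fin N)) : Prop where
  memLp : MemLp u (ENNReal.ofReal p) (volume.restrict Ω)
  memLp_grad : MemLp G (ENNReal.ofReal p) (volume.restrict Ω)
  hasWeakGradient : HasWeakGradient Ω u G

/-- `u ∈ W_0^{1,p}(Ω)` with weak gradient `G`: `u` belongs to `W^{1,p}(Ω)` and is the limit, in
the norm of `W^{1,p}(Ω)`, of a sequence of test functions on `Ω`. -/
structure MemSobolevZero {N : ℕ} (p : ℝ) (Ω : Set (EuclideanSpace ℝ (Fin N)))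
    (u : EuclideanSpace ℝ (Fin N) → ℝ)
    (G : EuclideanSpace ℝ (Fin N) → EuclideanSpace ℝ (Fin N)) : Prop where
  memSobolev : MemSobolev p Ω u G
  exists_approx : ∃ φ : ℕ → EuclideanSpace ℝ (Fin N) → ℝ,
    (∀ k, IsTestFunction Ω (φ k)) ∧
    Tendsto (fun k => eLpNorm (fun x => φ k x - u x) (ENNReal.ofReal p) (volume.restrict Ω))
      atTop (𝓝 0) ∧
    Tendsto (fun k => eLpNorm (fun x => gradient (φ k) x - G x) (ENNReal.ofReal p)
      (volume.restrict Ω)) atTop (𝓝 0)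

/-- `u` is a bounded weak solution of the Dirichlet problem
`-div (|∇u|^{p-2} ∇u) = lam * f(u)` in `Ω`, `u = 0` on `∂Ω`: that is,
`u ∈ W_0^{1,p}(Ω) ∩ L^∞(Ω)` and
`∫_Ω ⟨|∇u|^{p-2} ∇u, ∇φ⟩ = lam * ∫_Ω f(u) φ` for all test functions `φ` on `Ω`.
The field `|∇u|^{p-2} ∇u` is `0` where `∇u = 0`. -/
def IsBoundedWeakSolution {N : ℕ} (p : ℝ) (Ω : Set (EuclideanSpace ℝ (Fin N))) (lam : ℝ)
    (f : ℝ → ℝ) (u : EuclideanSpace ℝ (Fin N) → ℝ) : Prop :=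
  MemLp u ⊤ (volume.restrict Ω) ∧
  ∃ G : EuclideanSpace ℝ (Fin N) → EuclideanSpace ℝ (Fin N), MemSobolevZero p Ω u G ∧
    ∀ φ : EuclideanSpace ℝ (Fin N) → ℝ, IsTestFunction Ω φ →
      ∫ x in Ω, inner ℝ (‖G x‖ ^ (p - 2) • G x) (gradient φ x) = lam * ∫ x in Ω, f (u x) * φ x

/-- The filter on `ℝ` along which limits at `ℓ ∈ {0, ∞}` are taken: `s → 0⁺` if `ℓ = 0`, and
`s → ∞` otherwise. -/
def limitFilter (ℓ : ℝ≥0∞) : Filter ℝ := open Classical in if ℓ = 0 then 𝓝[>] 0 else atTop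

/-- The quotient `F(s) / s^p`, where `F(s) = ∫_0^s f(t) dt`, as an extended real number. -/
def primitiveQuotient (f : ℝ → ℝ) (p s : ℝ) : EReal := (((∫ t in (0 : ℝ)..s, f t) / s ^ p : ℝ) : EReal)

end

/-!
Solutions are obtained by the direct method, one below each zero `α` of `f`. Since `0 ≤ f 0` and
`f α = 0`, the nonlinearity can be replaced outside `[0, α]` by constants, and moving the values of a
function towards `[0, α]` does not increase the resulting energy
`(1/p) ∫_Ω |∇u|^p - lam ∫_Ω H(u)`. Minimizing this energy therefore yields a solution `u` with
`0 ≤ u ≤ α` whose energy is at most that of any test function with values in `[0, α]`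
(`exists_solution_le_zero_of_nonlinearity`).

The comparison functions are `s ψ`, where `ψ` is a cutoff equal to `1` on a compact set `K` that nearly
exhausts `Ω` and `F(s) / s^p` is close to its upper limit. With `F(t) ≥ -C t^p - D` off `K`, the energy
of `s ψ` is at most `s^p (A - lam (m |K| - C |Ω \ K|))` up to a constant (`energy_smul_cutoff_le`), and
the bracket is negative once `lam` is large, or for every `lam > 0` if `m` can be taken arbitrarily
large. For `ℓ = 0` the minimal energies are then negative, so the solutions, which lie below
`α n → 0`, do not vanish; for `ℓ = ∞` the minimal energies tend to `-∞`, so the solutions cannot stay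
bounded.

The existence of a minimizer (`exists_minimizer`) needs neither weak limits of gradients nor a calculus
of weak derivatives. A minimizing sequence is chosen among test functions, and a smooth truncation
(`exists_smooth_truncation`) confines its values to small neighbourhoods of `[0, α]`. A Rellich type
argument (`exists_subseq_integral_cauchy`) makes it Cauchy in `L¹`, so that the lower order term
converges. As the energy of a midpoint is not below the infimum, a quantitative strict convexity of
`|·|^p` (`exists_norm_sub_rpow_le_defect`) forces the gradients to be Cauchy in `L^p`; the limit is
thus in `W_0^{1,p}` by definition, and its Euler–Lagrange equation is `euler_lagrange`.
-/

/-! ### Uniform convexity of the `p`-th power of the norm -/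

theorem rpow_midpoint_le {p : ℝ} (hp : 1 < p) {x y : ℝ} (hx : 0 ≤ x) (hy : 0 ≤ y) :
    ((x + y) / 2) ^ p ≤ (x ^ p + y ^ p) / 2 := by
  have := (convexOn_rpow hp.le).2 (mem_Ici.2 hx) (mem_Ici.2 hy)
    (by norm_num : (0 : ℝ) ≤ 1 / 2) (by norm_num : (0 : ℝ) ≤ 1 / 2) (by norm_num)
  simp only [smul_eq_mul] at this
  calc ((x + y) / 2) ^ p = (1 / 2 * x + 1 / 2 * y) ^ p := by ring_nf
    _ ≤ _ := this
    _ = _ := by ring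

theorem norm_midpoint_rpow_le {E : Type*} [NormedAddCommGroup E] [NormedSpace ℝ E]
    {p : ℝ} (hp : 1 < p) (a b : E) :
    ‖(1 / 2 : ℝ) • (a + b)‖ ^ p ≤ (‖a‖ ^ p + ‖b‖ ^ p) / 2 := by
  refine le_trans ?_ (rpow_midpoint_le hp (norm_nonneg a) (norm_nonneg b))
  refine Real.rpow_le_rpow (norm_nonneg _) ?_ (by linarith)
  rw [norm_smul]
  have := norm_add_le a b
  norm_num
  linarith

theorem norm_midpoint_rpow_lt {E : Type*} [NormedAddCommGroup E] [NormedSpace ℝ E]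
    [StrictConvexSpace ℝ E] {p : ℝ} (hp : 1 < p) {a b : E} (hab : a ≠ b) :
    ‖(1 / 2 : ℝ) • (a + b)‖ ^ p < (‖a‖ ^ p + ‖b‖ ^ p) / 2 := by
  by_cases h : ‖a‖ = ‖b‖
  · have h1 : ‖(1 / 2 : ℝ) • (a + b)‖ < ‖a‖ := by
      have := norm_combo_lt_of_ne (r := ‖a‖) le_rfl h.ge hab (by norm_num : (0 : ℝ) < 1 / 2)
        (by norm_num : (0 : ℝ) < 1 / 2) (by norm_num)
      rwa [smul_add]
    have := Real.rpow_lt_rpow (norm_nonneg _) h1 (by linarith : 0 < p)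
    rw [← h]
    linarith
  · have h2 := (strictConvexOn_rpow hp).2 (mem_Ici.2 (norm_nonneg a)) (mem_Ici.2 (norm_nonneg b)) h
      (by norm_num : (0 : ℝ) < 1 / 2) (by norm_num : (0 : ℝ) < 1 / 2) (by norm_num)
    simp only [smul_eq_mul] at h2
    have h3 : ‖(1 / 2 : ℝ) • (a + b)‖ ^ p ≤ (1 / 2 * ‖a‖ + 1 / 2 * ‖b‖) ^ p := by
      refine Real.rpow_le_rpow (norm_nonneg _) ?_ (by linarith)
      rw [norm_smul]
      have := norm_add_le a b
      norm_num
      linarith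
    linarith

/-- Quantitative strict convexity of `‖·‖ ^ p`: up to an arbitrarily small multiple of
`‖a‖ ^ p + ‖b‖ ^ p`, the distance of `a` and `b` is controlled by the defect in the midpoint
inequality. By homogeneity it is enough to look at a compact sphere, where the defect vanishes only
on the diagonal. -/
theorem exists_norm_sub_rpow_le_defect {E : Type*} [NormedAddCommGroup E] [NormedSpace ℝ E]
    [StrictConvexSpace ℝ E] [ProperSpace E] {p : ℝ} (hp : 1 < p) {ε : ℝ} (hε : 0 < ε) :
    ∃ C : ℝ, 0 ≤ C ∧ ∀ a b : E, ‖a - b‖ ^ p ≤ ε * (‖a‖ ^ p + ‖b‖ ^ p) +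
      C * ((‖a‖ ^ p + ‖b‖ ^ p) / 2 - ‖(1 / 2 : ℝ) • (a + b)‖ ^ p) := by
  have hp0 : 0 < p := by linarith
  have hcn : ∀ g : E × E → E, Continuous g → Continuous fun z => ‖g z‖ ^ p := fun g hg =>
    hg.norm.rpow_const fun _ => Or.inr hp0.le
  -- the part of the unit sphere on which the first term alone does not suffice
  let S : Set (E × E) := Metric.sphere 0 1 ∩ {z | ε * (‖z.1‖ ^ p + ‖z.2‖ ^ p) ≤ ‖z.1 - z.2‖ ^ p}
  have hSc : IsCompact S := (isCompact_sphere _ _).inter_right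
    (isClosed_le (by have := hcn _ continuous_fst; have := hcn _ continuous_snd; fun_prop)
      (hcn _ (by fun_prop)))
  let D : E × E → ℝ := fun z => (‖z.1‖ ^ p + ‖z.2‖ ^ p) / 2 - ‖(1 / 2 : ℝ) • (z.1 + z.2)‖ ^ p
  have hDc : Continuous D := by
    have h1 := hcn _ continuous_fst
    have h2 := hcn _ continuous_snd
    have h3 := hcn (fun z => (1 / 2 : ℝ) • (z.1 + z.2)) (by fun_prop)
    exact ((h1.add h2).div_const 2).sub h3
  have hD0 : ∀ z, 0 ≤ D z := fun z => sub_nonneg.2 (norm_midpoint_rpow_le hp z.1 z.2)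
  have hDpos : ∀ z ∈ S, 0 < D z := by
    rintro ⟨a, b⟩ ⟨hz, hz2⟩
    refine sub_pos.2 (norm_midpoint_rpow_lt hp ?_)
    rintro (h : a = b)
    subst h
    simp only [mem_ofPred_eq, sub_self, norm_zero, Real.zero_rpow hp0.ne'] at hz2
    have ha : ‖a‖ = 1 := by simpa [Prod.norm_def] using hz
    rw [ha] at hz2
    norm_num at hz2
    linarith
  obtain ⟨C, hC0, hC⟩ : ∃ C : ℝ, 0 ≤ C ∧ ∀ z ∈ S, ‖z.1 - z.2‖ ^ p ≤ C * D z := by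
    have hq : ContinuousOn (fun z : E × E => ‖z.1 - z.2‖ ^ p / D z) S :=
      (hcn (fun z => z.1 - z.2) (by fun_prop)).continuousOn.div hDc.continuousOn
        fun z hz => (hDpos z hz).ne'
    obtain ⟨C, hC⟩ := (hSc.image_of_continuousOn hq).bddAbove
    refine ⟨max C 0, le_max_right _ _, fun z hz => ?_⟩
    have := hC ⟨z, hz, rfl⟩
    rw [← div_le_iff₀ (hDpos z hz)]
    exact this.trans (le_max_left _ _)
  have hsphere : ∀ z : E × E, ‖z‖ = 1 → ‖z.1 - z.2‖ ^ p ≤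
      ε * (‖z.1‖ ^ p + ‖z.2‖ ^ p) + C * D z := by
    intro z hz
    by_cases hzS : ε * (‖z.1‖ ^ p + ‖z.2‖ ^ p) ≤ ‖z.1 - z.2‖ ^ p
    · have := hC z ⟨by simpa using hz, hzS⟩
      have h2 : 0 ≤ ε * (‖z.1‖ ^ p + ‖z.2‖ ^ p) := by positivity
      linarith
    · have := mul_nonneg hC0 (hD0 z)
      linarith
  refine ⟨C, hC0, fun a b => ?_⟩
  by_cases h0 : ((a, b) : E × E) = 0
  · obtain ⟨rfl, rfl⟩ := Prod.mk_eq_zero.1 h0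
    simp [Real.zero_rpow hp0.ne']
  · set r := ‖((a, b) : E × E)‖ with hr
    have hrpos : 0 < r := norm_pos_iff.2 h0
    have hs : ∀ x : E, ‖x‖ ^ p = r ^ p * ‖r⁻¹ • x‖ ^ p := fun x => by
      rw [norm_smul, norm_inv, Real.norm_of_nonneg hrpos.le,
        Real.mul_rpow (by positivity) (norm_nonneg _), Real.inv_rpow hrpos.le,
        mul_inv_cancel_left₀ (by positivity)]
    have key := hsphere (r⁻¹ • (a, b)) (by
      rw [norm_smul, norm_inv, Real.norm_of_nonneg hrpos.le, ← hr, inv_mul_cancel₀ hrpos.ne'])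
    simp only [D, Prod.smul_fst, Prod.smul_snd] at key
    rw [← smul_sub, ← smul_add, smul_comm (1 / 2 : ℝ)] at key
    have := mul_le_mul_of_nonneg_left key (by positivity : 0 ≤ r ^ p)
    rw [hs (a - b), hs a, hs b, hs ((1 / 2 : ℝ) • (a + b))]
    linarith

/-! ### Convergence in `L^p` -/

section Lp

variable {α E : Type*} [MeasurableSpace α] [NormedAddCommGroup E] {μ : Measure α} {p : ℝ}

theorem integrable_norm_rpow_of_memLp (hp : 1 < p) {g : α → E}
    (hg : MemLp g (ENNReal.ofReal p) μ) : Integrable (fun x => ‖g x‖ ^ p) μ := by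
  have := hg.integrable_norm_rpow (by simpa using by linarith) ENNReal.ofReal_ne_top
  rwa [ENNReal.toReal_ofReal (by linarith)] at this

theorem eLpNorm_eq_ofReal_integral (hp : 1 < p) {g : α → E}
    (hg : MemLp g (ENNReal.ofReal p) μ) :
    eLpNorm g (ENNReal.ofReal p) μ = ENNReal.ofReal ((∫ x, ‖g x‖ ^ p ∂μ) ^ p⁻¹) := by
  rw [hg.eLpNorm_eq_integral_rpow_norm (by simpa using by linarith) ENNReal.ofReal_ne_top,
    ENNReal.toReal_ofReal (by linarith)]

theorem exists_memLp_tendsto_of_integral_cauchy [CompleteSpace E] (hp : 1 < p) {g : ℕ → α → E}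
    (hg : ∀ k, MemLp (g k) (ENNReal.ofReal p) μ)
    (hc : ∀ ε > 0, ∃ K, ∀ k ≥ K, ∀ j ≥ K, ∫ x, ‖g k x - g j x‖ ^ p ∂μ ≤ ε) :
    ∃ G : α → E, MemLp G (ENNReal.ofReal p) μ ∧
      Tendsto (fun k => eLpNorm (fun x => g k x - G x) (ENNReal.ofReal p) μ) atTop (𝓝 0) := by
  have hp0 : 0 < p := by linarith
  have : Fact (1 ≤ ENNReal.ofReal p) := ⟨by simpa using hp.le⟩
  have hcau : CauchySeq fun k => (hg k).toLp (g k) := by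
    rw [Metric.cauchySeq_iff]
    intro ε hε
    obtain ⟨K, hK⟩ := hc ((ε / 2) ^ p) (by positivity)
    refine ⟨K, fun k hk j hj => ?_⟩
    rw [Lp.dist_edist, Lp.edist_toLp_toLp, eLpNorm_eq_ofReal_integral hp ((hg k).sub (hg j)),
      ENNReal.toReal_ofReal (by positivity)]
    have h1 := Real.rpow_le_rpow (by positivity) (hK k hk j hj) (by positivity : 0 ≤ p⁻¹)
    rw [Real.rpow_rpow_inv (by positivity) hp0.ne'] at h1
    simp only [Pi.sub_apply]
    linarith
  obtain ⟨G, hG⟩ := cauchySeq_tendsto_of_complete hcau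
  refine ⟨G, Lp.memLp G, ?_⟩
  have h2 := (Lp.tendsto_Lp_iff_tendsto_eLpNorm' _ _).1 hG
  refine h2.congr fun k => eLpNorm_congr_ae ?_
  filter_upwards [(hg k).coeFn_toLp] with x hx
  simp [hx]

theorem tendsto_integral_norm_rpow (hp : 1 < p) {g : ℕ → α → E} {G : α → E}
    (hg : ∀ k, MemLp (g k) (ENNReal.ofReal p) μ) (hG : MemLp G (ENNReal.ofReal p) μ)
    (h : Tendsto (fun k => eLpNorm (fun x => g k x - G x) (ENNReal.ofReal p) μ) atTop (𝓝 0)) :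
    Tendsto (fun k => ∫ x, ‖g k x‖ ^ p ∂μ) atTop (𝓝 (∫ x, ‖G x‖ ^ p ∂μ)) := by
  have hp0 : 0 < p := by linarith
  have : Fact (1 ≤ ENNReal.ofReal p) := ⟨by simpa using hp.le⟩
  have h1 := ((Lp.tendsto_Lp_iff_tendsto_eLpNorm'' g hg G hG).2 h).norm.rpow_const
    (p := p) (Or.inr hp0.le)
  have h2 : ∀ (f : α → E) (hf : MemLp f (ENNReal.ofReal p) μ),
      ‖hf.toLp f‖ ^ p = ∫ x, ‖f x‖ ^ p ∂μ := fun f hf => by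
    rw [Lp.norm_toLp, eLpNorm_eq_ofReal_integral hp hf, ENNReal.toReal_ofReal (by positivity),
      Real.rpow_inv_rpow (by positivity) hp0.ne']
  simpa only [h2] using h1

theorem tendsto_integral_norm_sub [IsFiniteMeasure μ] (hp : 1 < p) {g : ℕ → α → E} {G : α → E}
    (hg : ∀ k, MemLp (g k) (ENNReal.ofReal p) μ) (hG : MemLp G (ENNReal.ofReal p) μ)
    (h : Tendsto (fun k => eLpNorm (fun x => g k x - G x) (ENNReal.ofReal p) μ) atTop (𝓝 0)) :
    Tendsto (fun k => ∫ x, ‖g k x - G x‖ ∂μ) atTop (𝓝 0) := by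
  have h1p : (1 : ℝ≥0∞) ≤ ENNReal.ofReal p := by simpa using hp.le
  have h1 : Tendsto (fun k => eLpNorm (fun x => g k x - G x) 1 μ) atTop (𝓝 0) := by
    have hc : μ univ ^ (1 / (1 : ℝ≥0∞).toReal - 1 / (ENNReal.ofReal p).toReal) ≠ ⊤ := by
      refine ENNReal.rpow_ne_top_of_nonneg ?_ (measure_ne_top _ _)
      rw [ENNReal.toReal_ofReal (by linarith), ENNReal.toReal_one, sub_nonneg]
      rw [div_le_div_iff₀ (by linarith) one_pos]
      linarith
    have h2 := ENNReal.Tendsto.mul_const h (Or.inr hc)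
    rw [zero_mul] at h2
    exact tendsto_of_tendsto_of_tendsto_of_le_of_le tendsto_const_nhds h2 (fun _ => zero_le)
      fun k => eLpNorm_le_eLpNorm_mul_rpow_measure_univ h1p ((hg k).sub hG).1
  have h3 := (ENNReal.tendsto_toReal ENNReal.zero_ne_top).comp h1
  rw [ENNReal.toReal_zero] at h3
  refine h3.congr fun k => ?_
  rw [Function.comp_apply, eLpNorm_one_eq_lintegral_enorm]
  exact (integral_norm_eq_lintegral_enorm ((hg k).sub hG).1).symm

end Lp

/-! ### Compactness of uniformly bounded test functions with bounded gradients -/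

/-- Sequential weak compactness of balls in `L²`, tested against indicator functions. -/
theorem exists_subseq_tendsto_setIntegral {α : Type*} [MeasurableSpace α] {μ : Measure α}
    [IsSeparable μ] {u : ℕ → α → ℝ} (hu : ∀ k, MemLp (u k) 2 μ) {R : ℝ}
    (hR : ∀ k, (eLpNorm (u k) 2 μ).toReal ≤ R) :
    ∃ ns : ℕ → ℕ, StrictMono ns ∧ ∀ s : Set α, MeasurableSet s → μ s ≠ ⊤ →
      ∃ c : ℝ, Tendsto (fun k => ∫ x in s, u (ns k) x ∂μ) atTop (𝓝 c) := by
  have : Fact ((2 : ℝ≥0∞) ≠ ⊤) := ⟨by simp⟩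
  let U : ℕ → WeakDual ℝ (Lp ℝ 2 μ) := fun k =>
    StrongDual.toWeakDual (InnerProductSpace.toDual ℝ (Lp ℝ 2 μ) ((hu k).toLp (u k)))
  have hU : ∀ k, U k ∈ WeakDual.toStrongDual ⁻¹' Metric.closedBall (0 : StrongDual ℝ (Lp ℝ 2 μ)) R := by
    intro k
    simp only [mem_preimage, mem_closedBall_zero_iff]
    change ‖InnerProductSpace.toDual ℝ (Lp ℝ 2 μ) ((hu k).toLp (u k))‖ ≤ R
    rw [LinearIsometryEquiv.norm_map, Lp.norm_toLp]
    exact hR k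
  obtain ⟨v, -, ns, hns, hv⟩ := WeakDual.isSeqCompact_closedBall ℝ (Lp ℝ 2 μ) 0 R hU
  refine ⟨ns, hns, fun s hs hμs => ⟨v (indicatorConstLp 2 hs hμs 1), ?_⟩⟩
  have h1 := ((WeakDual.eval_continuous (indicatorConstLp 2 hs hμs (1 : ℝ))).tendsto v).comp hv
  refine h1.congr fun k => ?_
  change inner ℝ ((hu (ns k)).toLp (u (ns k))) (indicatorConstLp 2 hs hμs (1 : ℝ)) = _
  rw [real_inner_comm, L2.inner_indicatorConstLp_one]
  exact setIntegral_congr_ae hs ((hu (ns k)).coeFn_toLp.mono fun x hx _ => hx)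

section Translation

variable {E : Type*} [NormedAddCommGroup E] [NormedSpace ℝ E] [MeasurableSpace E] [BorelSpace E]
  [FiniteDimensional ℝ E] (μ : Measure E) [μ.IsAddHaarMeasure]

theorem lintegral_enorm_translate_sub_le {u : E → ℝ} (hu : ContDiff ℝ 1 u) (y : E) :
    ∫⁻ x, ‖u (x + y) - u x‖ₑ ∂μ ≤ ‖y‖ₑ * ∫⁻ x, ‖fderiv ℝ u x‖ₑ ∂μ := by
  have hc : Continuous (fderiv ℝ u) := hu.continuous_fderiv one_ne_zero
  have hpt : ∀ x, ‖u (x + y) - u x‖ₑ ≤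
      ∫⁻ t in Ioc (0 : ℝ) 1, ‖y‖ₑ * ‖fderiv ℝ u (x + t • y)‖ₑ := by
    intro x
    have hd : ∀ t : ℝ, HasDerivAt (fun t : ℝ => u (x + t • y)) (fderiv ℝ u (x + t • y) y) t := by
      intro t
      have h1 : HasDerivAt (fun t : ℝ => x + t • y) y t := by
        simpa using ((hasDerivAt_id t).smul_const y).const_add x
      exact ((hu.differentiable one_ne_zero _).hasFDerivAt).comp_hasDerivAt t h1
    have hcd : Continuous fun t : ℝ => fderiv ℝ u (x + t • y) y :=
      (hc.comp (by fun_prop)).clm_apply continuous_const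
    have h2 := intervalIntegral.integral_eq_sub_of_hasDerivAt (fun t _ => hd t)
      (hcd.intervalIntegrable 0 1)
    simp only [one_smul, zero_smul, add_zero] at h2
    rw [← h2, intervalIntegral.integral_of_le zero_le_one]
    refine (enorm_integral_le_lintegral_enorm _).trans (lintegral_mono fun t => ?_)
    rw [mul_comm]
    exact ContinuousLinearMap.le_opENorm _ _
  have hc2 : Continuous fun z : E × ℝ => ‖fderiv ℝ u (z.1 + z.2 • y)‖ₑ :=
    (hc.comp (by fun_prop)).enorm
  calc ∫⁻ x, ‖u (x + y) - u x‖ₑ ∂μ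
      ≤ ∫⁻ x, (∫⁻ t in Ioc (0 : ℝ) 1, ‖y‖ₑ * ‖fderiv ℝ u (x + t • y)‖ₑ) ∂μ := lintegral_mono hpt
    _ = ∫⁻ t in Ioc (0 : ℝ) 1, ∫⁻ x, ‖y‖ₑ * ‖fderiv ℝ u (x + t • y)‖ₑ ∂μ :=
        lintegral_lintegral_swap (hc2.measurable.const_mul _).aemeasurable
    _ = ∫⁻ t in Ioc (0 : ℝ) 1, ‖y‖ₑ * ∫⁻ x, ‖fderiv ℝ u x‖ₑ ∂μ := by
        refine lintegral_congr fun t => ?_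
        rw [lintegral_const_mul' _ _ (by simp),
          lintegral_add_right_eq_self (fun x => ‖fderiv ℝ u x‖ₑ)]
    _ = _ := by simp

omit [NormedSpace ℝ E] [FiniteDimensional ℝ E] in
theorem setIntegral_ball_eq_translate (u : E → ℝ) (x : E) (r : ℝ) :
    ∫ y in Metric.ball x r, u y ∂μ = ∫ y in Metric.ball (0 : E) r, u (x + y) ∂μ := by
  have h1 := (measurePreserving_add_left μ x).setIntegral_preimage_emb
    (measurableEmbedding_addLeft x) u (Metric.ball x r)
  rw [← h1]
  congr 2
  ext y
  simp

theorem stronglyMeasurable_setIntegral_ball {u : E → ℝ} (hu : Continuous u) (r : ℝ) :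
    StronglyMeasurable fun x => ∫ y in Metric.ball x r, u y ∂μ := by
  simp_rw [setIntegral_ball_eq_translate μ u]
  exact StronglyMeasurable.integral_prod_right (f := fun x y => u (x + y))
    (Continuous.stronglyMeasurable (by fun_prop))

theorem norm_average_ball_le {u : E → ℝ} {C : ℝ} (hC : ∀ x, |u x| ≤ C) {r : ℝ} (hr : 0 < r)
    (x : E) :
    ‖(μ.real (Metric.ball (0 : E) r))⁻¹ * ∫ y in Metric.ball x r, u y ∂μ‖ ≤ C := by
  have hBpos : 0 < μ.real (Metric.ball (0 : E) r) :=
    ENNReal.toReal_pos (Metric.measure_ball_pos μ 0 hr).ne' measure_ball_lt_top.ne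
  have h1 := norm_setIntegral_le_of_norm_le_const (μ := μ) (s := Metric.ball (0 : E) r)
    (f := fun y => u (x + y)) measure_ball_lt_top (fun y _ => hC (x + y))
  rw [setIntegral_ball_eq_translate, norm_mul, norm_inv, Real.norm_of_nonneg hBpos.le,
    inv_mul_le_iff₀ hBpos, mul_comm]
  exact h1

/-- A function differs from its averages over balls of radius `r` by at most `r ‖∇u‖₁` in `L¹`. -/
theorem lintegral_enorm_sub_average_le {u : E → ℝ} (hu : ContDiff ℝ 1 u) {r : ℝ} (hr : 0 < r) :
    ∫⁻ x, ‖u x - (μ.real (Metric.ball 0 r))⁻¹ * ∫ y in Metric.ball x r, u y ∂μ‖ₑ ∂μ ≤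
      ENNReal.ofReal r * ∫⁻ x, ‖fderiv ℝ u x‖ₑ ∂μ := by
  set B := Metric.ball (0 : E) r with hB
  have hBpos : 0 < μ B := Metric.measure_ball_pos μ 0 hr
  have hBtop : μ B ≠ ⊤ := measure_ball_lt_top.ne
  have hBr : 0 < μ.real B := ENNReal.toReal_pos hBpos.ne' hBtop
  have hint : ∀ x, IntegrableOn (fun y => u (x + y)) B μ := fun x =>
    ((hu.continuous.comp (by fun_prop : Continuous fun y => x + y)).continuousOn.integrableOn_compact
      (isCompact_closedBall 0 r)).mono_set Metric.ball_subset_closedBall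
  have hpt : ∀ x, ‖u x - (μ.real B)⁻¹ * ∫ y in Metric.ball x r, u y ∂μ‖ₑ ≤
      (μ B)⁻¹ * ∫⁻ y in B, ‖u (x + y) - u x‖ₑ ∂μ := by
    intro x
    have h1 : u x - (μ.real B)⁻¹ * ∫ y in Metric.ball x r, u y ∂μ =
        -((μ.real B)⁻¹ * ∫ y in B, (u (x + y) - u x) ∂μ) := by
      rw [setIntegral_ball_eq_translate μ u x r, integral_sub (hint x) (integrableOn_const hBtop), setIntegral_const, smul_eq_mul]
      field_simp
      ring
    rw [h1, enorm_neg, enorm_mul]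
    refine mul_le_mul' (le_of_eq ?_) (enorm_integral_le_lintegral_enorm _)
    rw [Real.enorm_of_nonneg (by positivity), ENNReal.ofReal_inv_of_pos hBr, ofReal_measureReal hBtop]
  have hm : Measurable fun z : E × E => ‖u (z.1 + z.2) - u z.1‖ₑ := by
    have := hu.continuous
    exact Continuous.measurable (by fun_prop)
  calc _ ≤ ∫⁻ x, (μ B)⁻¹ * ∫⁻ y in B, ‖u (x + y) - u x‖ₑ ∂μ ∂μ := lintegral_mono hpt
    _ = (μ B)⁻¹ * ∫⁻ x, ∫⁻ y in B, ‖u (x + y) - u x‖ₑ ∂μ ∂μ :=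
        lintegral_const_mul' _ _ (ENNReal.inv_ne_top.2 hBpos.ne')
    _ = (μ B)⁻¹ * ∫⁻ y in B, ∫⁻ x, ‖u (x + y) - u x‖ₑ ∂μ ∂μ := by
        rw [lintegral_lintegral_swap hm.aemeasurable]
    _ ≤ (μ B)⁻¹ * ∫⁻ y in B, ENNReal.ofReal r * ∫⁻ x, ‖fderiv ℝ u x‖ₑ ∂μ ∂μ := by
        refine mul_le_mul' le_rfl (setLIntegral_mono measurable_const fun y hy => ?_)
        refine (lintegral_enorm_translate_sub_le μ hu y).trans (mul_le_mul' ?_ le_rfl)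
        rw [← ofReal_norm]
        exact ENNReal.ofReal_le_ofReal (mem_ball_zero_iff.1 hy).le
    _ = ENNReal.ofReal r * ∫⁻ x, ‖fderiv ℝ u x‖ₑ ∂μ := by
        rw [setLIntegral_const, mul_comm _ (μ B), ← mul_assoc, ENNReal.inv_mul_cancel hBpos.ne' hBtop,
          one_mul]

/-- **Rellich compactness**, for uniformly bounded functions: a sequence of `C¹` functions supported
in a set `Ω` of finite measure, bounded uniformly and with gradients bounded in `L¹`, has a
subsequence that is Cauchy in `L¹(Ω)`. The averages over small balls converge along a weakly
convergent subsequence, and they are uniformly close to the functions in `L¹`. -/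
theorem exists_subseq_integral_cauchy {Ω : Set E} (hΩm : MeasurableSet Ω) (hΩ : μ Ω ≠ ⊤)
    {u : ℕ → E → ℝ}
    (hu : ∀ k, ContDiff ℝ 1 (u k)) (hsupp : ∀ k, ∀ x ∉ Ω, u k x = 0) {C : ℝ}
    (hC : ∀ k x, |u k x| ≤ C) {M : ℝ≥0∞} (hM : M ≠ ⊤) (hgrad : ∀ k, ∫⁻ x, ‖fderiv ℝ (u k) x‖ₑ ∂μ ≤ M) :
    ∃ ns : ℕ → ℕ, StrictMono ns ∧ ∀ ε > 0, ∃ K, ∀ k ≥ K, ∀ j ≥ K,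
      ∫ x in Ω, |u (ns k) x - u (ns j) x| ∂μ ≤ ε := by
  have : IsFiniteMeasure (μ.restrict Ω) := ⟨by simpa using hΩ.lt_top⟩
  have hind : ∀ k, Ω.indicator (u k) = u k := fun k =>
    indicator_eq_self.2 fun x hx => by_contra fun h => hx (hsupp k x h)
  have hmem : ∀ k, MemLp (u k) 2 μ := fun k => by
    rw [← hind k, memLp_indicator_iff_restrict hΩm]
    exact MemLp.of_bound (hu k).continuous.aestronglyMeasurable C (Eventually.of_forall (hC k))
  have hnorm : ∀ k, (eLpNorm (u k) 2 μ).toReal ≤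
      (eLpNorm (fun _ : E => C) 2 (μ.restrict Ω)).toReal := by
    intro k
    refine ENNReal.toReal_mono (memLp_const C).eLpNorm_ne_top ?_
    rw [← hind k, eLpNorm_indicator_eq_eLpNorm_restrict hΩm]
    exact eLpNorm_mono fun x => (hC k x).trans (le_abs_self C)
  obtain ⟨ns, hns, hlim⟩ := exists_subseq_tendsto_setIntegral hmem hnorm
  refine ⟨ns, hns, fun ε hε => ?_⟩
  obtain ⟨r, hr, hrM⟩ : ∃ r : ℝ, 0 < r ∧ ENNReal.ofReal r * (M + M) ≤ ENNReal.ofReal (ε / 2) := by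
    refine ⟨ε / (4 * (M.toReal + 1)), by positivity, ?_⟩
    lift M to NNReal using hM
    rw [← ENNReal.coe_add, ← ENNReal.ofReal_coe_nnreal (p := M + M), ← ENNReal.ofReal_mul (by positivity)]
    refine ENNReal.ofReal_le_ofReal ?_
    simp only [ENNReal.coe_toReal, NNReal.coe_add]
    rw [div_mul_eq_mul_div, div_le_iff₀ (by positivity)]
    nlinarith [M.coe_nonneg]
  set B := Metric.ball (0 : E) r with hB
  -- the averages over balls of radius `r`, and their pointwise limit
  let a : ℕ → E → ℝ := fun k x => (μ.real B)⁻¹ * ∫ y in Metric.ball x r, u (ns k) y ∂μ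
  have hbd : ∀ k x, ‖a k x‖ ≤ C := fun k x => norm_average_ball_le μ (hC (ns k)) hr x
  have hameas : ∀ k, AEStronglyMeasurable (a k) (μ.restrict Ω) := fun k =>
    ((stronglyMeasurable_setIntegral_ball μ (hu (ns k)).continuous r).const_mul
      _).aestronglyMeasurable
  choose b hb using fun x : E =>
    hlim (Metric.ball x r) measurableSet_ball measure_ball_lt_top.ne
  have hab : ∀ x, Tendsto (fun k => a k x) atTop (𝓝 ((μ.real B)⁻¹ * b x)) :=
    fun x => (hb x).const_mul _
  have hconv := tendsto_lintegral_norm_of_dominated_convergence (μ := μ.restrict Ω) hameas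
    (integrable_const C).2 (fun k => Eventually.of_forall (hbd k)) (Eventually.of_forall hab)
  obtain ⟨K, hK⟩ := eventually_atTop.1 (hconv.eventually_le_const
    (ENNReal.ofReal_pos.2 (by positivity : 0 < ε / 4)))
  refine ⟨K, fun k hk j hj => ?_⟩
  set w : E → ℝ := fun x => u (ns k) x - u (ns j) x with hw
  have hwC : ContDiff ℝ 1 w := (hu _).sub (hu _)
  have hgw : ∫⁻ x, ‖fderiv ℝ w x‖ₑ ∂μ ≤ M + M := by
    calc ∫⁻ x, ‖fderiv ℝ w x‖ₑ ∂μ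
        ≤ ∫⁻ x, ‖fderiv ℝ (u (ns k)) x‖ₑ + ‖fderiv ℝ (u (ns j)) x‖ₑ ∂μ := by
          refine lintegral_mono fun x => ?_
          rw [hw, fderiv_fun_sub ((hu _).differentiable one_ne_zero _)
            ((hu _).differentiable one_ne_zero _)]
          exact enorm_sub_le
      _ = _ := lintegral_add_left ((hu _).continuous_fderiv one_ne_zero).enorm.measurable _
      _ ≤ _ := add_le_add (hgrad _) (hgrad _)
  have hint : ∀ i x, IntegrableOn (u i) (Metric.ball x r) μ := fun i x =>
    ((hu i).continuous.continuousOn.integrableOn_compact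
      (isCompact_closedBall x r)).mono_set Metric.ball_subset_closedBall
  have hAw : ∀ x, (μ.real B)⁻¹ * ∫ y in Metric.ball x r, w y ∂μ = a k x - a j x := fun x => by
    simp only [hw, a]
    rw [integral_sub (hint _ x) (hint _ x), mul_sub]
  have hle : ∫⁻ x in Ω, ‖w x‖ₑ ∂μ ≤ ENNReal.ofReal ε := by
    have hbm : AEStronglyMeasurable (fun x => (μ.real B)⁻¹ * b x) (μ.restrict Ω) :=
      aestronglyMeasurable_of_tendsto_ae _ hameas (Eventually.of_forall hab)
    calc ∫⁻ x in Ω, ‖w x‖ₑ ∂μ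
        ≤ ∫⁻ x in Ω, (‖w x - (μ.real B)⁻¹ * ∫ y in Metric.ball x r, w y ∂μ‖ₑ +
          (ENNReal.ofReal ‖a k x - (μ.real B)⁻¹ * b x‖ +
            ENNReal.ofReal ‖a j x - (μ.real B)⁻¹ * b x‖)) ∂μ := by
          refine lintegral_mono fun x => ?_
          rw [hAw, ofReal_norm, ofReal_norm]
          calc ‖w x‖ₑ = ‖(w x - (a k x - a j x)) + ((a k x - (μ.real B)⁻¹ * b x) -
                (a j x - (μ.real B)⁻¹ * b x))‖ₑ := by congr 1; ring
            _ ≤ _ := (enorm_add_le _ _).trans (add_le_add le_rfl enorm_sub_le)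
      _ = (∫⁻ x in Ω, ‖w x - (μ.real B)⁻¹ * ∫ y in Metric.ball x r, w y ∂μ‖ₑ ∂μ) +
          ((∫⁻ x in Ω, ENNReal.ofReal ‖a k x - (μ.real B)⁻¹ * b x‖ ∂μ) +
            ∫⁻ x in Ω, ENNReal.ofReal ‖a j x - (μ.real B)⁻¹ * b x‖ ∂μ) := by
          rw [lintegral_add_right', lintegral_add_right']
          · exact ((hameas j).sub hbm).norm.aemeasurable.ennreal_ofReal
          · exact ((hameas k).sub hbm).norm.aemeasurable.ennreal_ofReal.add
              ((hameas j).sub hbm).norm.aemeasurable.ennreal_ofReal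
      _ ≤ ENNReal.ofReal (ε / 2) + (ENNReal.ofReal (ε / 4) + ENNReal.ofReal (ε / 4)) := by
          refine add_le_add ?_ (add_le_add (hK k hk) (hK j hj))
          refine (setLIntegral_le_lintegral _ _).trans ?_
          refine (lintegral_enorm_sub_average_le μ hwC hr).trans ?_
          exact (mul_le_mul' le_rfl hgw).trans hrM
      _ = ENNReal.ofReal ε := by
          rw [← ENNReal.ofReal_add (by positivity) (by positivity),
            ← ENNReal.ofReal_add (by positivity) (by positivity)]
          congr 1
          ring
  have h5 := integral_norm_eq_lintegral_enorm (μ := μ.restrict Ω) hwC.continuous.aestronglyMeasurable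
  simp only [Real.norm_eq_abs] at h5
  rw [h5]
  exact (ENNReal.toReal_mono ENNReal.ofReal_ne_top hle).trans_eq (ENNReal.toReal_ofReal hε.le)

end Translation

/-! ### Test functions -/

namespace IsTestFunction

variable {N : ℕ} {Ω : Set (EuclideanSpace ℝ (Fin N))} {φ ψ : EuclideanSpace ℝ (Fin N) → ℝ}

theorem differentiable (hφ : IsTestFunction Ω φ) : Differentiable ℝ φ :=
  hφ.contDiff.differentiable (by simp)

theorem continuous (hφ : IsTestFunction Ω φ) : Continuous φ := hφ.contDiff.continuous

theorem eq_zero_of_notMem (hφ : IsTestFunction Ω φ) {x : EuclideanSpace ℝ (Fin N)} (hx : x ∉ Ω) :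
    φ x = 0 :=
  image_eq_zero_of_notMem_tsupport fun h => hx (hφ.tsupport_subset h)

theorem comp_left (hφ : IsTestFunction Ω φ) {T : ℝ → ℝ} (hT : ContDiff ℝ ∞ T) (hT0 : T 0 = 0) :
    IsTestFunction Ω fun x => T (φ x) where
  contDiff := hT.comp hφ.contDiff
  hasCompactSupport := hφ.hasCompactSupport.comp_left hT0
  tsupport_subset := (closure_mono (Function.support_comp_subset hT0 φ)).trans hφ.tsupport_subset

theorem const_mul (hφ : IsTestFunction Ω φ) (c : ℝ) : IsTestFunction Ω fun x => c * φ x :=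
  hφ.comp_left (T := fun s => c * s) (contDiff_const.mul contDiff_id) (mul_zero c)

theorem add (hφ : IsTestFunction Ω φ) (hψ : IsTestFunction Ω ψ) :
    IsTestFunction Ω fun x => φ x + ψ x where
  contDiff := hφ.contDiff.add hψ.contDiff
  hasCompactSupport := hφ.hasCompactSupport.add hψ.hasCompactSupport
  tsupport_subset := (tsupport_add φ ψ).trans
    (union_subset hφ.tsupport_subset hψ.tsupport_subset)

theorem zero : IsTestFunction Ω fun _ => 0 where
  contDiff := contDiff_const
  hasCompactSupport := HasCompactSupport.zero
  tsupport_subset := by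
    have : tsupport (fun _ : EuclideanSpace ℝ (Fin N) => (0 : ℝ)) = ∅ := tsupport_eq_empty_iff.2 rfl
    simp [this]

theorem continuous_gradient (hφ : IsTestFunction Ω φ) : Continuous (gradient φ) :=
  (InnerProductSpace.toDual ℝ _).symm.continuous.comp
    (hφ.contDiff.continuous_fderiv (by simp))

theorem hasCompactSupport_gradient (hφ : IsTestFunction Ω φ) : HasCompactSupport (gradient φ) :=
  (hφ.hasCompactSupport.fderiv ℝ).comp_left
    (g := (InnerProductSpace.toDual ℝ (EuclideanSpace ℝ (Fin N))).symm) (map_zero _)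

theorem memLp (hφ : IsTestFunction Ω φ) (q : ℝ≥0∞) : MemLp φ q (volume.restrict Ω) :=
  (hφ.continuous.memLp_of_hasCompactSupport hφ.hasCompactSupport).restrict Ω

theorem memLp_gradient (hφ : IsTestFunction Ω φ) (q : ℝ≥0∞) :
    MemLp (gradient φ) q (volume.restrict Ω) :=
  (hφ.continuous_gradient.memLp_of_hasCompactSupport hφ.hasCompactSupport_gradient).restrict Ω

theorem gradient_add (hφ : IsTestFunction Ω φ) (hψ : IsTestFunction Ω ψ)
    (x : EuclideanSpace ℝ (Fin N)) :
    gradient (fun x => φ x + ψ x) x = gradient φ x + gradient ψ x := by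
  simp only [gradient]
  rw [fderiv_fun_add (hφ.differentiable x) (hψ.differentiable x), map_add]

theorem gradient_comp (hφ : IsTestFunction Ω φ) {T : ℝ → ℝ} (hT : Differentiable ℝ T)
    (x : EuclideanSpace ℝ (Fin N)) :
    gradient (fun x => T (φ x)) x = deriv T (φ x) • gradient φ x := by
  simp only [gradient]
  have h1 := ((hT (φ x)).hasDerivAt.comp_hasFDerivAt x (hφ.differentiable x).hasFDerivAt).fderiv
  rw [show (fun x => T (φ x)) = T ∘ φ from rfl, h1, map_smul]

theorem gradient_const_mul (hφ : IsTestFunction Ω φ) (c : ℝ) (x : EuclideanSpace ℝ (Fin N)) :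
    gradient (fun x => c * φ x) x = c • gradient φ x := by
  rw [hφ.gradient_comp (T := fun s => c * s) (by fun_prop)]
  simp

theorem norm_gradient (φ : EuclideanSpace ℝ (Fin N) → ℝ) (x : EuclideanSpace ℝ (Fin N)) :
    ‖gradient φ x‖ = ‖fderiv ℝ φ x‖ :=
  LinearIsometryEquiv.norm_map _ _

theorem exists_bound (hφ : IsTestFunction Ω φ) :
    ∃ C : ℝ, 0 ≤ C ∧ (∀ x, |φ x| ≤ C) ∧ ∀ x, ‖gradient φ x‖ ≤ C := by
  obtain ⟨C₁, h₁⟩ := hφ.hasCompactSupport.exists_bound_of_continuous hφ.continuous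
  obtain ⟨C₂, h₂⟩ := hφ.hasCompactSupport_gradient.exists_bound_of_continuous
    hφ.continuous_gradient
  exact ⟨max C₁ C₂, (norm_nonneg _).trans ((h₁ 0).trans (le_max_left _ _)),
    fun x => (h₁ x).trans (le_max_left _ _), fun x => (h₂ x).trans (le_max_right _ _)⟩

theorem gradient_eq_zero_of_notMem (hφ : IsTestFunction Ω φ) {x : EuclideanSpace ℝ (Fin N)}
    (hx : x ∉ Ω) : gradient φ x = 0 := by
  have h1 : fderiv ℝ φ x = 0 := by
    by_contra h
    exact hx (hφ.tsupport_subset (support_fderiv_subset ℝ h))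
  simp [gradient, h1]

/-- Integration by parts for two test functions. -/
theorem integral_mul_fderiv (hφ : IsTestFunction Ω φ) (hψ : IsTestFunction Ω ψ)
    (v : EuclideanSpace ℝ (Fin N)) :
    ∫ x in Ω, φ x * fderiv ℝ ψ x v = - ∫ x in Ω, ψ x * inner ℝ (gradient φ x) v := by
  have hc : ∀ {φ ψ : EuclideanSpace ℝ (Fin N) → ℝ}, IsTestFunction Ω φ → IsTestFunction Ω ψ →
      Integrable (fun x => φ x * fderiv ℝ ψ x v) := fun {φ ψ} h1 h2 =>
    (h1.continuous.mul ((h2.contDiff.continuous_fderiv (by simp)).clm_apply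
      continuous_const)).integrable_of_hasCompactSupport h1.hasCompactSupport.mul_right
  have h1 := integral_mul_fderiv_eq_neg_fderiv_mul_of_integrable (μ := volume) (v := v)
    ((hc hψ hφ).congr (Eventually.of_forall fun x => mul_comm _ _)) (hc hφ hψ)
    ((hφ.continuous.mul hψ.continuous).integrable_of_hasCompactSupport
      hφ.hasCompactSupport.mul_right) (fun x _ => hφ.differentiable x)
    fun x _ => hψ.differentiable x
  rw [setIntegral_eq_integral_of_forall_compl_eq_zero, setIntegral_eq_integral_of_forall_compl_eq_zero,
    h1]
  · congr 1
    refine integral_congr_ae (Eventually.of_forall fun x => ?_)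
    simp only [inner_gradient_left, mul_comm]
  · intro x hx
    simp [hψ.eq_zero_of_notMem hx]
  · intro x hx
    simp [hφ.eq_zero_of_notMem hx]

end IsTestFunction

/-! ### Primitives and smooth truncation -/

section Primitive

variable {h : ℝ → ℝ}

theorem continuous_primitive_of_continuous (hh : Continuous h) :
    Continuous fun s => ∫ t in (0 : ℝ)..s, h t :=
  intervalIntegral.continuous_primitive (fun a b => hh.intervalIntegrable a b) 0

theorem abs_primitive_sub_le (hh : Continuous h) {B : ℝ} (hB : ∀ s, |h s| ≤ B) (a b : ℝ) :
    |(∫ t in (0 : ℝ)..a, h t) - ∫ t in (0 : ℝ)..b, h t| ≤ B * |a - b| := by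
  rw [intervalIntegral.integral_interval_sub_left (hh.intervalIntegrable _ _)
    (hh.intervalIntegrable _ _)]
  exact intervalIntegral.norm_integral_le_of_norm_le_const (f := h) fun x _ => hB x

/-- Smooth truncation to a small neighbourhood of `[0, α]`: `T` is the identity on `[0, α]`, is
monotone and nonexpansive, takes values in `[-ε, α + ε]`, and moves every point towards
`[0, α]`. -/
theorem exists_smooth_truncation {α ε : ℝ} (hα : 0 < α) (hε : 0 < ε) :
    ∃ T : ℝ → ℝ, ContDiff ℝ ∞ T ∧ T 0 = 0 ∧ (∀ s, |deriv T s| ≤ 1) ∧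
      (∀ s, -ε ≤ T s ∧ T s ≤ α + ε) ∧ (∀ s ∈ Icc 0 α, T s = s) ∧
      (∀ s ≤ 0, s ≤ T s ∧ T s ≤ 0) ∧ (∀ s, α ≤ s → α ≤ T s) := by
  let η : ContDiffBump (α / 2 : ℝ) := ⟨α / 2, α / 2 + ε, by positivity, by linarith⟩
  have hηc : Continuous η := η.continuous
  have hi : ∀ a b, IntervalIntegrable η volume a b := fun a b => hηc.intervalIntegrable a b
  let T : ℝ → ℝ := fun s => ∫ t in (0 : ℝ)..s, η t
  have hTd : ∀ s, HasDerivAt T (η s) s := fun s =>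
    intervalIntegral.integral_hasDerivAt_right (hi 0 s) (hηc.stronglyMeasurableAtFilter _ _)
      hηc.continuousAt
  have hsub : ∀ a b, T b - T a = ∫ t in a..b, η t := fun a b =>
    intervalIntegral.integral_interval_sub_left (hi _ _) (hi _ _)
  have hT0 : T 0 = 0 := intervalIntegral.integral_same
  have hge : ∀ a b, a ≤ b → T a ≤ T b := fun a b hab => by
    rw [← sub_nonneg, hsub]
    exact intervalIntegral.integral_nonneg hab fun t _ => η.nonneg
  have hle : ∀ a b, a ≤ b → T b - T a ≤ b - a := fun a b hab => by
    rw [hsub]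
    have := intervalIntegral.integral_mono_on hab (hi a b)
      (intervalIntegrable_const (c := (1 : ℝ)) (μ := volume)) fun t _ => η.le_one
    simpa using this
  have hid : ∀ s ∈ Icc 0 α, T s = s := by
    intro s hs
    have h1 : ∫ t in (0 : ℝ)..s, η t = ∫ t in (0 : ℝ)..s, (1 : ℝ) := by
      refine intervalIntegral.integral_congr fun t ht => η.one_of_mem_closedBall ?_
      rw [uIcc_of_le hs.1] at ht
      have h2 : η.rIn = α / 2 := rfl
      rw [h2, Real.closedBall_eq_Icc]
      constructor <;> linarith [ht.1, ht.2, hs.2]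
    simp only [T, h1]
    simp
  have hzero : ∀ a b, (∀ t ∈ uIcc a b, α / 2 + ε ≤ dist t (α / 2)) → T b = T a := by
    intro a b hab
    rw [← sub_eq_zero, hsub, intervalIntegral.integral_congr (g := fun _ => (0 : ℝ))
      fun t ht => η.zero_of_le_dist (hab t ht)]
    simp
  have hTα : T α = α := hid α ⟨hα.le, le_rfl⟩
  have hderiv : deriv T = η := funext fun s => (hTd s).deriv
  refine ⟨T, ?_, hT0, ?_, ?_, hid, ?_, ?_⟩
  · rw [contDiff_infty_iff_deriv, hderiv]
    exact ⟨fun s => (hTd s).differentiableAt, η.contDiff⟩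
  · intro s
    rw [hderiv, abs_of_nonneg η.nonneg]
    exact η.le_one
  · intro s
    have h1 := hle (-ε) 0 (by linarith)
    have h2 := hle α (α + ε) (by linarith)
    constructor
    · rcases le_total (-ε) s with hs | hs
      · linarith [hge _ _ hs]
      · rw [hzero (-ε) s fun t ht => ?_]
        · linarith
        · rw [uIcc_of_ge hs] at ht
          rw [Real.dist_eq, abs_sub_comm]
          exact le_trans (by linarith [ht.2]) (le_abs_self _)
    · rcases le_total s (α + ε) with hs | hs
      · linarith [hge _ _ hs]
      · rw [hzero (α + ε) s fun t ht => ?_]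
        · linarith
        · rw [uIcc_of_le hs] at ht
          rw [Real.dist_eq]
          exact le_trans (by linarith [ht.1]) (le_abs_self _)
  · intro s hs
    exact ⟨by linarith [hle s 0 hs], by linarith [hge s 0 hs]⟩
  · intro s hs
    linarith [hge α s hs]

/-- If `h` is nonnegative on `(-∞, 0]` and vanishes on `[α, ∞)`, its primitive does not decrease when
points are moved towards `[0, α]`. -/
theorem primitive_le_primitive_comp (hh : Continuous h) {α : ℝ} (hneg : ∀ s ≤ 0, 0 ≤ h s)
    (hbig : ∀ s, α ≤ s → h s = 0) {T : ℝ → ℝ} (hid : ∀ s ∈ Icc 0 α, T s = s)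
    (hT1 : ∀ s ≤ 0, s ≤ T s ∧ T s ≤ 0) (hT2 : ∀ s, α ≤ s → α ≤ T s) (s : ℝ) :
    ∫ t in (0 : ℝ)..s, h t ≤ ∫ t in (0 : ℝ)..(T s), h t := by
  rw [← sub_nonneg, intervalIntegral.integral_interval_sub_left (hh.intervalIntegrable _ _)
    (hh.intervalIntegrable _ _)]
  rcases le_total s 0 with hs | hs
  · obtain ⟨h1, h2⟩ := hT1 s hs
    exact intervalIntegral.integral_nonneg h1 fun t ht => hneg t (ht.2.trans h2)
  · rcases le_total s α with hs2 | hs2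
    · rw [hid s ⟨hs, hs2⟩, intervalIntegral.integral_same]
    · rw [intervalIntegral.integral_congr (g := fun _ => (0 : ℝ)) fun t ht => hbig t ?_]
      · simp
      · exact (le_inf hs2 (hT2 s hs2)).trans ht.1

end Primitive

/-! ### The energy functional -/

/-- The energy `(1/p) ∫_Ω |G|^p - lam ∫_Ω H(u)` of a function `u` with gradient field `G`, where `H`
is a primitive of the right-hand side of the equation. -/
noncomputable def energy {N : ℕ} (p lam : ℝ) (H : ℝ → ℝ) (Ω : Set (EuclideanSpace ℝ (Fin N)))
    (u : EuclideanSpace ℝ (Fin N) → ℝ)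
    (G : EuclideanSpace ℝ (Fin N) → EuclideanSpace ℝ (Fin N)) : ℝ :=
  1 / p * (∫ x in Ω, ‖G x‖ ^ p) - lam * ∫ x in Ω, H (u x)

theorem tendsto_integral_of_norm_sub_le {α E : Type*} [MeasurableSpace α] [NormedAddCommGroup E]
    {μ : Measure α} {F : ℕ → α → ℝ} {F₀ : α → ℝ} {g : ℕ → α → E} {G : α → E} {C : ℝ}
    (hF : ∀ k, Integrable (F k) μ) (hF₀ : Integrable F₀ μ) (hg : ∀ k, Integrable (g k) μ)
    (hG : Integrable G μ) (hle : ∀ k x, |F k x - F₀ x| ≤ C * ‖g k x - G x‖)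
    (h : Tendsto (fun k => ∫ x, ‖g k x - G x‖ ∂μ) atTop (𝓝 0)) :
    Tendsto (fun k => ∫ x, F k x ∂μ) atTop (𝓝 (∫ x, F₀ x ∂μ)) := by
  rw [tendsto_iff_dist_tendsto_zero]
  have h2 := h.const_mul C
  rw [mul_zero] at h2
  refine squeeze_zero (fun _ => dist_nonneg) (fun k => ?_) h2
  rw [Real.dist_eq, ← integral_sub (hF k) hF₀, ← integral_const_mul]
  refine (abs_integral_le_integral_abs).trans ?_
  exact integral_mono ((hF k).sub hF₀).abs (((hg k).sub hG).norm.const_mul C) (hle k)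

theorem integrable_of_memLp_ofReal {α E : Type*} [MeasurableSpace α] [NormedAddCommGroup E]
    {μ : Measure α} [IsFiniteMeasure μ] {p : ℝ} (hp : 1 < p) {g : α → E}
    (hg : MemLp g (ENNReal.ofReal p) μ) : Integrable g μ :=
  hg.integrable (by simpa using hp.le)

section Energy

variable {N : ℕ} {Ω : Set (EuclideanSpace ℝ (Fin N))} [IsFiniteMeasure (volume.restrict Ω)]
  {p lam : ℝ} {H : ℝ → ℝ} {B : ℝ}

omit [IsFiniteMeasure (volume.restrict Ω)] in
theorem integrable_comp_of_lipschitz (hH : Continuous H) (hH0 : H 0 = 0)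
    (hB : ∀ a b, |H a - H b| ≤ B * |a - b|) {u : EuclideanSpace ℝ (Fin N) → ℝ}
    (hu : Integrable u (volume.restrict Ω)) : Integrable (fun x => H (u x)) (volume.restrict Ω) := by
  refine (hu.abs.const_mul B).mono' (hH.comp_aestronglyMeasurable hu.1)
    (Eventually.of_forall fun x => ?_)
  simpa [hH0] using hB (u x) 0

theorem tendsto_energy (hp : 1 < p) (hH : Continuous H) (hH0 : H 0 = 0)
    (hB : ∀ a b, |H a - H b| ≤ B * |a - b|)
    {w : ℕ → EuclideanSpace ℝ (Fin N) → ℝ} {u : EuclideanSpace ℝ (Fin N) → ℝ}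
    {g : ℕ → EuclideanSpace ℝ (Fin N) → EuclideanSpace ℝ (Fin N)}
    {G : EuclideanSpace ℝ (Fin N) → EuclideanSpace ℝ (Fin N)}
    (hw : ∀ k, MemLp (w k) (ENNReal.ofReal p) (volume.restrict Ω))
    (hu : MemLp u (ENNReal.ofReal p) (volume.restrict Ω))
    (hg : ∀ k, MemLp (g k) (ENNReal.ofReal p) (volume.restrict Ω))
    (hG : MemLp G (ENNReal.ofReal p) (volume.restrict Ω))
    (hwu : Tendsto (fun k => eLpNorm (fun x => w k x - u x) (ENNReal.ofReal p)
      (volume.restrict Ω)) atTop (𝓝 0))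
    (hgG : Tendsto (fun k => eLpNorm (fun x => g k x - G x) (ENNReal.ofReal p)
      (volume.restrict Ω)) atTop (𝓝 0)) :
    Tendsto (fun k => energy p lam H Ω (w k) (g k)) atTop (𝓝 (energy p lam H Ω u G)) := by
  have hi : ∀ {v}, MemLp v (ENNReal.ofReal p) (volume.restrict Ω) →
      Integrable v (volume.restrict Ω) := fun {v : EuclideanSpace ℝ (Fin N) → ℝ} hv =>
    integrable_of_memLp_ofReal hp hv
  refine ((tendsto_integral_norm_rpow hp hg hG hgG).const_mul _).sub (Tendsto.const_mul _ ?_)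
  exact tendsto_integral_of_norm_sub_le
    (fun k => integrable_comp_of_lipschitz hH hH0 hB (hi (hw k)))
    (integrable_comp_of_lipschitz hH hH0 hB (hi hu)) (fun k => hi (hw k)) (hi hu)
    (fun k x => hB _ _) (tendsto_integral_norm_sub hp hw hu hwu)

theorem integral_norm_rpow_le_energy (hp : 1 < p) (hlam : 0 ≤ lam) {b : ℝ} (hb : ∀ s, H s ≤ b)
    {u : EuclideanSpace ℝ (Fin N) → ℝ}
    {G : EuclideanSpace ℝ (Fin N) → EuclideanSpace ℝ (Fin N)}
    (hHu : Integrable (fun x => H (u x)) (volume.restrict Ω)) :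
    ∫ x in Ω, ‖G x‖ ^ p ≤ p * (energy p lam H Ω u G + lam * (b * volume.real Ω)) := by
  have h1 : ∫ x in Ω, H (u x) ≤ b * volume.real Ω := by
    have := integral_mono hHu (integrable_const b) fun x => hb (u x)
    simpa [mul_comm] using this
  have h2 := mul_le_mul_of_nonneg_left h1 hlam
  have hp0 : 0 < p := by linarith
  have h3 : ∫ x in Ω, ‖G x‖ ^ p = p * (energy p lam H Ω u G + lam * ∫ x in Ω, H (u x)) := by
    rw [energy]
    field_simp
    ring
  rw [h3]
  gcongr

omit [IsFiniteMeasure (volume.restrict Ω)] in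
/-- The convexity defect of the gradient term is controlled by that of the energy, up to an error
that is small when the functions are close in `L¹`. -/
theorem integral_defect_le_energy (hp : 1 < p) (hlam : 0 ≤ lam) (hH : Continuous H) (hH0 : H 0 = 0)
    (hB : ∀ a b, |H a - H b| ≤ B * |a - b|)
    {u v : EuclideanSpace ℝ (Fin N) → ℝ}
    {g k : EuclideanSpace ℝ (Fin N) → EuclideanSpace ℝ (Fin N)}
    (hu : Integrable u (volume.restrict Ω)) (hv : Integrable v (volume.restrict Ω))
    (hg : MemLp g (ENNReal.ofReal p) (volume.restrict Ω))
    (hk : MemLp k (ENNReal.ofReal p) (volume.restrict Ω)) :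
    ∫ x in Ω, ((‖g x‖ ^ p + ‖k x‖ ^ p) / 2 - ‖(1 / 2 : ℝ) • (g x + k x)‖ ^ p) ≤
      p * ((energy p lam H Ω u g + energy p lam H Ω v k) / 2 -
        energy p lam H Ω (fun x => 1 / 2 * (u x + v x)) (fun x => (1 / 2 : ℝ) • (g x + k x)) +
        lam * (B / 2 * ∫ x in Ω, |u x - v x|)) := by
  have hp0 : 0 < p := by linarith
  have hig := integrable_norm_rpow_of_memLp hp hg
  have hik := integrable_norm_rpow_of_memLp hp hk
  have him := integrable_norm_rpow_of_memLp hp ((hg.add hk).const_smul (1 / 2 : ℝ))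
  simp only [Pi.smul_apply, Pi.add_apply] at him
  have hHu := integrable_comp_of_lipschitz hH hH0 hB hu
  have hHv := integrable_comp_of_lipschitz hH hH0 hB hv
  have hHm := integrable_comp_of_lipschitz hH hH0 hB ((hu.add hv).const_mul (1 / 2 : ℝ))
  simp only [Pi.add_apply] at hHm
  have hHs : Integrable (fun x => H (u x) / 2 + H (v x) / 2) (volume.restrict Ω) :=
    (hHu.div_const 2).add (hHv.div_const 2)
  have higk : Integrable (fun x => (‖g x‖ ^ p + ‖k x‖ ^ p) / 2) (volume.restrict Ω) :=
    (hig.add hik).div_const 2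
  have h1 : (∫ x in Ω, H (u x)) / 2 + (∫ x in Ω, H (v x)) / 2 -
      (∫ x in Ω, H (1 / 2 * (u x + v x))) ≤ B / 2 * ∫ x in Ω, |u x - v x| := by
    rw [← integral_div, ← integral_div, ← integral_add (hHu.div_const 2) (hHv.div_const 2),
      ← integral_sub hHs hHm, ← integral_const_mul]
    refine integral_mono (hHs.sub hHm)
      ((hu.sub hv).abs.const_mul _) fun x => ?_
    have e1 := (le_abs_self _).trans (hB (u x) (1 / 2 * (u x + v x)))
    have e2 := (le_abs_self _).trans (hB (v x) (1 / 2 * (u x + v x)))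
    have e3 : |u x - 1 / 2 * (u x + v x)| = |u x - v x| / 2 := by
      rw [show u x - 1 / 2 * (u x + v x) = (u x - v x) / 2 by ring, abs_div, abs_two]
    have e4 : |v x - 1 / 2 * (u x + v x)| = |u x - v x| / 2 := by
      rw [show v x - 1 / 2 * (u x + v x) = -((u x - v x) / 2) by ring, abs_neg, abs_div, abs_two]
    rw [e3] at e1
    rw [e4] at e2
    dsimp only
    linarith
  have h2 := mul_le_mul_of_nonneg_left h1 hlam
  rw [integral_sub higk him, integral_div, integral_add hig hik]
  have h3 : ((∫ x in Ω, ‖g x‖ ^ p) + ∫ x in Ω, ‖k x‖ ^ p) / 2 -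
      ∫ x in Ω, ‖(1 / 2 : ℝ) • (g x + k x)‖ ^ p =
      p * ((energy p lam H Ω u g + energy p lam H Ω v k) / 2 -
        energy p lam H Ω (fun x => 1 / 2 * (u x + v x)) (fun x => (1 / 2 : ℝ) • (g x + k x)) +
        lam * ((∫ x in Ω, H (u x)) / 2 + (∫ x in Ω, H (v x)) / 2 -
          ∫ x in Ω, H (1 / 2 * (u x + v x)))) := by
    simp only [energy]
    field_simp
    ring
  rw [h3]
  gcongr

/-- A limit of test functions in the norm of `W^{1,p}` belongs to `W_0^{1,p}`. -/
theorem memSobolevZero_of_tendsto (hp : 1 < p)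
    {w : ℕ → EuclideanSpace ℝ (Fin N) → ℝ} (hw : ∀ k, IsTestFunction Ω (w k))
    {u : EuclideanSpace ℝ (Fin N) → ℝ}
    {G : EuclideanSpace ℝ (Fin N) → EuclideanSpace ℝ (Fin N)}
    (hu : MemLp u (ENNReal.ofReal p) (volume.restrict Ω))
    (hG : MemLp G (ENNReal.ofReal p) (volume.restrict Ω))
    (hwu : Tendsto (fun k => eLpNorm (fun x => w k x - u x) (ENNReal.ofReal p)
      (volume.restrict Ω)) atTop (𝓝 0))
    (hgG : Tendsto (fun k => eLpNorm (fun x => gradient (w k) x - G x) (ENNReal.ofReal p)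
      (volume.restrict Ω)) atTop (𝓝 0)) :
    MemSobolevZero p Ω u G := by
  have hui := integrable_of_memLp_ofReal hp hu
  have hGi := integrable_of_memLp_ofReal hp hG
  refine ⟨⟨hu, hG, ⟨?_, ?_, ?_⟩⟩, w, hw, hwu, hgG⟩
  · exact IntegrableOn.locallyIntegrableOn hui
  · exact IntegrableOn.locallyIntegrableOn hGi
  · intro φ hφ v
    obtain ⟨C, hC0, hC1, hC2⟩ := hφ.exists_bound
    have hdc : Continuous fun x => fderiv ℝ φ x v :=
      (hφ.contDiff.continuous_fderiv (by simp)).clm_apply continuous_const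
    have hdb : ∀ x, |fderiv ℝ φ x v| ≤ C * ‖v‖ := fun x => by
      rw [← inner_gradient_left]
      exact (abs_real_inner_le_norm _ _).trans (by gcongr; exact hC2 x)
    have hI1 : ∀ {f : EuclideanSpace ℝ (Fin N) → ℝ}, Integrable f (volume.restrict Ω) →
        Integrable (fun x => f x * fderiv ℝ φ x v) (volume.restrict Ω) := fun hf =>
      hf.mul_bdd hdc.aestronglyMeasurable (Eventually.of_forall hdb)
    have hI2 : ∀ {f : EuclideanSpace ℝ (Fin N) → EuclideanSpace ℝ (Fin N)},
        Integrable f (volume.restrict Ω) →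
        Integrable (fun x => φ x * inner ℝ (f x) v) (volume.restrict Ω) := fun hf =>
      (hf.inner_const v).bdd_mul hφ.continuous.aestronglyMeasurable (Eventually.of_forall hC1)
    have hwi : ∀ k, Integrable (w k) (volume.restrict Ω) := fun k =>
      integrable_of_memLp_ofReal hp ((hw k).memLp _)
    have hgi : ∀ k, Integrable (gradient (w k)) (volume.restrict Ω) := fun k =>
      integrable_of_memLp_ofReal hp ((hw k).memLp_gradient _)
    have t1 : Tendsto (fun k => ∫ x in Ω, w k x * fderiv ℝ φ x v) atTop
        (𝓝 (∫ x in Ω, u x * fderiv ℝ φ x v)) := by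
      refine tendsto_integral_of_norm_sub_le (C := C * ‖v‖) (fun k => hI1 (hwi k)) (hI1 hui)
        hwi hui (fun k x => ?_) (tendsto_integral_norm_sub hp (fun k => (hw k).memLp _) hu hwu)
      rw [← sub_mul, abs_mul, mul_comm, Real.norm_eq_abs]
      gcongr
      exact hdb x
    have t2 : Tendsto (fun k => ∫ x in Ω, φ x * inner ℝ (gradient (w k) x) v) atTop
        (𝓝 (∫ x in Ω, φ x * inner ℝ (G x) v)) := by
      refine tendsto_integral_of_norm_sub_le (C := C * ‖v‖) (fun k => hI2 (hgi k)) (hI2 hGi)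
        hgi hGi (fun k x => ?_)
        (tendsto_integral_norm_sub hp (fun k => (hw k).memLp_gradient _) hG hgG)
      rw [← mul_sub, ← inner_sub_left, abs_mul]
      calc |φ x| * |inner ℝ (gradient (w k) x - G x) v|
          ≤ C * (‖gradient (w k) x - G x‖ * ‖v‖) :=
            mul_le_mul (hC1 x) (abs_real_inner_le_norm _ _) (abs_nonneg _) hC0
        _ = _ := by ring
    refine tendsto_nhds_unique t1 (t2.neg.congr fun k => ?_)
    rw [(hw k).integral_mul_fderiv hφ]

end Energy

/-! ### Minimizers and the Euler–Lagrange equation -/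

theorem norm_rpow_sub_two_mul_abs_inner_le {E : Type*} [NormedAddCommGroup E] [InnerProductSpace ℝ E]
    {p : ℝ} (hp : 1 < p) (a b : E) : ‖a‖ ^ (p - 2) * |inner ℝ a b| ≤ ‖a‖ ^ (p - 1) * ‖b‖ := by
  rcases eq_or_ne a 0 with rfl | ha
  · simp [Real.zero_rpow (by linarith : p - 1 ≠ 0)]
  · have h0 : 0 < ‖a‖ := norm_pos_iff.2 ha
    calc ‖a‖ ^ (p - 2) * |inner ℝ a b| ≤ ‖a‖ ^ (p - 2) * (‖a‖ * ‖b‖) := by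
          gcongr
          exact abs_real_inner_le_norm _ _
      _ = ‖a‖ ^ (p - 1) * ‖b‖ := by
          rw [show p - 1 = (p - 2) + 1 by ring, Real.rpow_add_one h0.ne', mul_assoc]

section EulerLagrange

variable {N : ℕ} {Ω : Set (EuclideanSpace ℝ (Fin N))} [IsFiniteMeasure (volume.restrict Ω)]
  {p lam : ℝ}

theorem hasDerivAt_integral_norm_rpow (hp : 1 < p)
    {G b : EuclideanSpace ℝ (Fin N) → EuclideanSpace ℝ (Fin N)}
    (hG : MemLp G (ENNReal.ofReal p) (volume.restrict Ω))
    (hb : AEStronglyMeasurable b (volume.restrict Ω)) {C : ℝ} (hC : ∀ x, ‖b x‖ ≤ C) :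
    HasDerivAt (fun t : ℝ => ∫ x in Ω, ‖G x + t • b x‖ ^ p)
      (∫ x in Ω, p * ‖G x‖ ^ (p - 2) * inner ℝ (G x) (b x)) 0 := by
  have hp0 : 0 < p := by linarith
  have hC0 : 0 ≤ C := (norm_nonneg _).trans (hC 0)
  have hbL : MemLp b (ENNReal.ofReal p) (volume.restrict Ω) :=
    MemLp.of_bound hb C (Eventually.of_forall hC)
  have hmeas : ∀ t : ℝ, AEStronglyMeasurable (fun x => G x + t • b x) (volume.restrict Ω) :=
    fun t => hG.1.add (hb.const_smul t)
  have hbdint : Integrable (fun x => p * (1 + C + ‖G x‖) ^ p * C) (volume.restrict Ω) := by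
    have h1 : MemLp (fun x => 1 + C + ‖G x‖) (ENNReal.ofReal p) (volume.restrict Ω) :=
      (memLp_const (1 + C)).add hG.norm
    have h2 := integrable_norm_rpow_of_memLp hp h1
    refine ((h2.const_mul p).mul_const C).congr (Eventually.of_forall fun x => ?_)
    simp only
    rw [Real.norm_of_nonneg (by positivity)]
  have key := hasDerivAt_integral_of_dominated_loc_of_deriv_le (μ := volume.restrict Ω)
    (F := fun (t : ℝ) x => ‖G x + t • b x‖ ^ p) (x₀ := (0 : ℝ)) (s := Metric.ball 0 1)
    (F' := fun t x => p * ‖G x + t • b x‖ ^ (p - 2) * inner ℝ (G x + t • b x) (b x))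
    (bound := fun x => p * (1 + C + ‖G x‖) ^ p * C) (Metric.ball_mem_nhds _ one_pos) ?_ ?_ ?_ ?_
    hbdint ?_
  · simpa using key.2
  · exact Eventually.of_forall fun t =>
      ((hmeas t).norm.aemeasurable.pow_const _).aestronglyMeasurable
  · simpa using integrable_norm_rpow_of_memLp hp hG
  · exact (((hmeas 0).norm.aemeasurable.pow_const _).aestronglyMeasurable.const_mul p).mul
      ((hmeas 0).inner hb)
  · refine Eventually.of_forall fun x t ht => ?_
    have ht1 : |t| ≤ 1 := by simpa using (mem_ball_zero_iff.1 ht).le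
    have h1 : ‖G x + t • b x‖ ≤ C + ‖G x‖ := by
      calc ‖G x + t • b x‖ ≤ ‖G x‖ + |t| * ‖b x‖ := (norm_add_le _ _).trans (by rw [norm_smul]; rfl)
        _ ≤ ‖G x‖ + 1 * C := by gcongr; exact hC x
        _ = _ := by ring
    calc ‖p * ‖G x + t • b x‖ ^ (p - 2) * inner ℝ (G x + t • b x) (b x)‖
        = p * (‖G x + t • b x‖ ^ (p - 2) * |inner ℝ (G x + t • b x) (b x)|) := by
          rw [norm_mul, norm_mul, Real.norm_of_nonneg hp0.le, Real.norm_of_nonneg (by positivity),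
            Real.norm_eq_abs, mul_assoc]
      _ ≤ p * (‖G x + t • b x‖ ^ (p - 1) * ‖b x‖) := by
          exact mul_le_mul_of_nonneg_left (norm_rpow_sub_two_mul_abs_inner_le hp _ _) hp0.le
      _ ≤ p * ((1 + C + ‖G x‖) ^ p * C) := by
          gcongr
          · calc ‖G x + t • b x‖ ^ (p - 1) ≤ (1 + C + ‖G x‖) ^ (p - 1) :=
                  Real.rpow_le_rpow (norm_nonneg _) (by linarith) (by linarith)
              _ ≤ (1 + C + ‖G x‖) ^ p :=
                  Real.rpow_le_rpow_of_exponent_le (by linarith [norm_nonneg (G x)]) (by linarith)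
          · exact hC x
      _ = _ := by ring
  · refine Eventually.of_forall fun x t _ => ?_
    have h1 : HasDerivAt (fun t : ℝ => G x + t • b x) (b x) t := by
      simpa using ((hasDerivAt_id t).smul_const (b x)).const_add (G x)
    exact (hasFDerivAt_norm_rpow (G x + t • b x) hp).comp_hasDerivAt t h1

theorem hasDerivAt_integral_primitive {h : ℝ → ℝ} (hh : Continuous h) {B : ℝ}
    (hB : ∀ s, |h s| ≤ B) {u φ : EuclideanSpace ℝ (Fin N) → ℝ}
    (hu : Integrable u (volume.restrict Ω))
    (hφ : AEStronglyMeasurable φ (volume.restrict Ω)) {C : ℝ} (hC : ∀ x, |φ x| ≤ C) :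
    HasDerivAt (fun t : ℝ => ∫ x in Ω, ∫ r in (0 : ℝ)..(u x + t * φ x), h r)
      (∫ x in Ω, h (u x) * φ x) 0 := by
  have hB0 : 0 ≤ B := (abs_nonneg _).trans (hB 0)
  have hHc := continuous_primitive_of_continuous hh
  have hmeas : ∀ t : ℝ, AEStronglyMeasurable (fun x => u x + t * φ x) (volume.restrict Ω) :=
    fun t => hu.1.add (hφ.const_mul t)
  have key := hasDerivAt_integral_of_dominated_loc_of_deriv_le (μ := volume.restrict Ω)
    (F := fun (t : ℝ) x => ∫ r in (0 : ℝ)..(u x + t * φ x), h r) (x₀ := (0 : ℝ)) (s := univ)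
    (F' := fun t x => h (u x + t * φ x) * φ x)
    (bound := fun _ => B * C) univ_mem ?_ ?_ ?_ ?_ (integrable_const _) ?_
  · simpa using key.2
  · exact Eventually.of_forall fun t => hHc.comp_aestronglyMeasurable (hmeas t)
  · simpa using integrable_comp_of_lipschitz hHc intervalIntegral.integral_same
      (abs_primitive_sub_le hh hB) hu
  · exact (hh.comp_aestronglyMeasurable (hmeas 0)).mul hφ
  · refine Eventually.of_forall fun x t _ => ?_
    rw [norm_mul]
    exact mul_le_mul (hB _) (hC x) (norm_nonneg _) hB0
  · refine Eventually.of_forall fun x t _ => ?_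
    have h1 : HasDerivAt (fun t : ℝ => u x + t * φ x) (φ x) t := by
      simpa using ((hasDerivAt_id t).mul_const (φ x)).const_add (u x)
    exact (intervalIntegral.integral_hasDerivAt_right (hh.intervalIntegrable _ _)
      (hh.stronglyMeasurableAtFilter _ _) hh.continuousAt).comp t h1

/-- The Euler–Lagrange equation of an element of `W_0^{1,p}` whose energy does not exceed that of any
test function. -/
theorem euler_lagrange (hp : 1 < p) {h : ℝ → ℝ} (hh : Continuous h) {B : ℝ}
    (hB : ∀ s, |h s| ≤ B) {u : EuclideanSpace ℝ (Fin N) → ℝ}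
    {G : EuclideanSpace ℝ (Fin N) → EuclideanSpace ℝ (Fin N)} (hu : MemSobolevZero p Ω u G)
    (hmin : ∀ φ, IsTestFunction Ω φ →
      energy p lam (fun s => ∫ t in (0 : ℝ)..s, h t) Ω u G ≤
        energy p lam (fun s => ∫ t in (0 : ℝ)..s, h t) Ω φ (gradient φ))
    {φ : EuclideanSpace ℝ (Fin N) → ℝ} (hφ : IsTestFunction Ω φ) :
    ∫ x in Ω, inner ℝ (‖G x‖ ^ (p - 2) • G x) (gradient φ x) = lam * ∫ x in Ω, h (u x) * φ x := by
  have hp0 : 0 < p := by linarith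
  obtain ⟨C, hC0, hC1, hC2⟩ := hφ.exists_bound
  obtain ⟨w, hw, hwu, hgG⟩ := hu.exists_approx
  have huL := hu.memSobolev.memLp
  have hGL := hu.memSobolev.memLp_grad
  have hHc := continuous_primitive_of_continuous hh
  -- the energy of `u + t φ` is a limit of energies of test functions
  have hvar : ∀ t : ℝ, energy p lam (fun s => ∫ t in (0 : ℝ)..s, h t) Ω u G ≤
      energy p lam (fun s => ∫ t in (0 : ℝ)..s, h t) Ω (fun x => u x + t * φ x)
        (fun x => G x + t • gradient φ x) := by
    intro t
    have ht := hφ.const_mul t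
    have hlim := tendsto_energy (lam := lam) (w := fun k x => w k x + t * φ x)
      (u := fun x => u x + t * φ x) (g := fun k x => gradient (w k) x + t • gradient φ x)
      (G := fun x => G x + t • gradient φ x) hp hHc intervalIntegral.integral_same
      (abs_primitive_sub_le hh hB) (fun k => ((hw k).memLp _).add (ht.memLp _))
      (huL.add (ht.memLp _)) (fun k => ((hw k).memLp_gradient _).add
        ((hφ.memLp_gradient _).const_smul t)) (hGL.add ((hφ.memLp_gradient _).const_smul t))
      (by simpa using hwu) (by simpa using hgG)
    refine ge_of_tendsto' hlim fun k => ?_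
    have := hmin _ ((hw k).add ht)
    have hg : gradient (fun x => w k x + t * φ x) = fun x => gradient (w k) x + t • gradient φ x := by
      ext1 x
      rw [(hw k).gradient_add ht, hφ.gradient_const_mul]
    rwa [hg] at this
  have hd := ((hasDerivAt_integral_norm_rpow hp hGL hφ.continuous_gradient.aestronglyMeasurable
    hC2).const_mul (1 / p)).sub ((hasDerivAt_integral_primitive hh hB
      (integrable_of_memLp_ofReal hp huL) hφ.continuous.aestronglyMeasurable hC1).const_mul lam)
  have hloc : IsLocalMin (fun t : ℝ => 1 / p * (∫ x in Ω, ‖G x + t • gradient φ x‖ ^ p) -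
      lam * ∫ x in Ω, ∫ r in (0 : ℝ)..(u x + t * φ x), h r) 0 := by
    refine Eventually.of_forall fun t => ?_
    simpa [energy] using hvar t
  have h0 := hloc.hasDerivAt_eq_zero hd
  have h1 : ∫ x in Ω, p * ‖G x‖ ^ (p - 2) * inner ℝ (G x) (gradient φ x) =
      p * ∫ x in Ω, inner ℝ (‖G x‖ ^ (p - 2) • G x) (gradient φ x) := by
    rw [← integral_const_mul]
    refine integral_congr_ae (Eventually.of_forall fun x => ?_)
    simp only [real_inner_smul_left, mul_assoc]
  rw [h1, ← mul_assoc, one_div_mul_cancel hp0.ne', one_mul] at h0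
  linarith

end EulerLagrange

/-! ### Existence of a minimizer -/

section Existence

variable {N : ℕ} {Ω : Set (EuclideanSpace ℝ (Fin N))} [IsFiniteMeasure (volume.restrict Ω)]
  {p lam : ℝ} {h : ℝ → ℝ} {B α : ℝ}

theorem primitive_le_of_truncated (hh : Continuous h) (hB : ∀ s, |h s| ≤ B) (hα : 0 < α)
    (hneg : ∀ s ≤ 0, 0 ≤ h s) (hbig : ∀ s, α ≤ s → h s = 0) (s : ℝ) :
    ∫ t in (0 : ℝ)..s, h t ≤ B * α := by
  have hB0 : 0 ≤ B := (abs_nonneg _).trans (hB 0)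
  have h1 := primitive_le_primitive_comp hh hneg hbig (T := fun s => max 0 (min s α))
    (fun s hs => by simp [hs.1, hs.2]) (fun s hs => by simp [hs, hs.trans hα.le])
    (fun s hs => by simp [hs, hα.le]) s
  have h2 := (le_abs_self _).trans (abs_primitive_sub_le hh hB (max 0 (min s α)) 0)
  rw [intervalIntegral.integral_same, sub_zero, sub_zero, abs_of_nonneg (le_max_left _ _)] at h2
  refine h1.trans (h2.trans (mul_le_mul_of_nonneg_left ?_ hB0))
  exact max_le hα.le (min_le_right _ _)

/-- Replacing a test function by a smooth truncation of it near `[0, α]` does not increase the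
energy. -/
theorem exists_truncated_test_energy_le (hp : 1 < p) (hlam : 0 ≤ lam) (hh : Continuous h)
    (hB : ∀ s, |h s| ≤ B) (hα : 0 < α) (hneg : ∀ s ≤ 0, 0 ≤ h s)
    (hbig : ∀ s, α ≤ s → h s = 0) {φ : EuclideanSpace ℝ (Fin N) → ℝ} (hφ : IsTestFunction Ω φ)
    {ε : ℝ} (hε : 0 < ε) :
    ∃ ψ, IsTestFunction Ω ψ ∧ (∀ x, -ε ≤ ψ x ∧ ψ x ≤ α + ε) ∧
      energy p lam (fun s => ∫ t in (0 : ℝ)..s, h t) Ω ψ (gradient ψ) ≤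
        energy p lam (fun s => ∫ t in (0 : ℝ)..s, h t) Ω φ (gradient φ) := by
  obtain ⟨T, hTc, hT0, hTd, hTb, hid, hT1, hT2⟩ := exists_smooth_truncation hα hε
  have hψ := hφ.comp_left hTc hT0
  have hHc := continuous_primitive_of_continuous hh
  have hp0 : 0 < p := by linarith
  have hi : ∀ {w}, IsTestFunction Ω w →
      Integrable (fun x => ∫ t in (0 : ℝ)..w x, h t) (volume.restrict Ω) := fun hw =>
    integrable_comp_of_lipschitz hHc intervalIntegral.integral_same
      (abs_primitive_sub_le hh hB) ((hw.memLp 1).integrable le_rfl)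
  refine ⟨_, hψ, fun x => hTb _, ?_⟩
  unfold energy
  refine sub_le_sub (mul_le_mul_of_nonneg_left ?_ (by positivity))
    (mul_le_mul_of_nonneg_left ?_ hlam)
  · refine integral_mono (integrable_norm_rpow_of_memLp hp (hψ.memLp_gradient _))
      (integrable_norm_rpow_of_memLp hp (hφ.memLp_gradient _)) fun x => ?_
    dsimp only
    rw [hφ.gradient_comp (hTc.differentiable (by simp)), norm_smul]
    refine Real.rpow_le_rpow (by positivity) ?_ hp0.le
    exact mul_le_of_le_one_left (norm_nonneg _) (hTd _)
  · exact integral_mono (hi hφ) (hi hψ) fun x =>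
      primitive_le_primitive_comp hh hneg hbig hid hT1 hT2 (φ x)

/-- A minimizing sequence of test functions with values close to `[0, α]`, and the infimum `m` of the
energy over all test functions. -/
theorem exists_minimizing_seq (hp : 1 < p) (hlam : 0 ≤ lam) (hh : Continuous h)
    (hB : ∀ s, |h s| ≤ B) (hα : 0 < α) (hneg : ∀ s ≤ 0, 0 ≤ h s)
    (hbig : ∀ s, α ≤ s → h s = 0) :
    ∃ (m : ℝ) (w : ℕ → EuclideanSpace ℝ (Fin N) → ℝ), (∀ k, IsTestFunction Ω (w k)) ∧
      (∀ (k : ℕ) x, -(1 / (k + 1 : ℝ)) ≤ w k x ∧ w k x ≤ α + 1 / (k + 1 : ℝ)) ∧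
      (∀ φ, IsTestFunction Ω φ →
        m ≤ energy p lam (fun s => ∫ t in (0 : ℝ)..s, h t) Ω φ (gradient φ)) ∧
      ∀ k, energy p lam (fun s => ∫ t in (0 : ℝ)..s, h t) Ω (w k) (gradient (w k)) ≤
        m + 1 / (k + 1 : ℝ) := by
  have hHc := continuous_primitive_of_continuous hh
  have hp0 : 0 < p := by linarith
  let S : Set ℝ := {e | ∃ φ, IsTestFunction Ω φ ∧
    e = energy p lam (fun s => ∫ t in (0 : ℝ)..s, h t) Ω φ (gradient φ)}
  have hSne : S.Nonempty := ⟨_, _, IsTestFunction.zero, rfl⟩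
  have hSb : BddBelow S := by
    refine ⟨-(lam * (B * α * volume.real Ω)), ?_⟩
    rintro _ ⟨φ, hφ, rfl⟩
    have h1 := integral_norm_rpow_le_energy (G := gradient φ) hp hlam
      (primitive_le_of_truncated hh hB hα hneg hbig)
      (integrable_comp_of_lipschitz hHc intervalIntegral.integral_same
        (abs_primitive_sub_le hh hB) ((hφ.memLp 1).integrable le_rfl))
    have h2 : 0 ≤ ∫ x in Ω, ‖gradient φ x‖ ^ p := by positivity
    have h4 := nonneg_of_mul_nonneg_right (h2.trans h1) hp0
    linarith
  have hex : ∀ k : ℕ, ∃ ψ, IsTestFunction Ω ψ ∧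
      (∀ x, -(1 / (k + 1 : ℝ)) ≤ ψ x ∧ ψ x ≤ α + 1 / (k + 1 : ℝ)) ∧
      energy p lam (fun s => ∫ t in (0 : ℝ)..s, h t) Ω ψ (gradient ψ) ≤
        sInf S + 1 / (k + 1 : ℝ) := by
    intro k
    have hk : (0 : ℝ) < 1 / (k + 1 : ℝ) := by positivity
    obtain ⟨_, ⟨φ, hφ, rfl⟩, hlt⟩ := exists_lt_of_csInf_lt hSne (lt_add_of_pos_right (sInf S) hk)
    obtain ⟨ψ, hψ, hb, hle⟩ := exists_truncated_test_energy_le hp hlam hh hB hα hneg hbig hφ hk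
    exact ⟨ψ, hψ, hb, hle.trans hlt.le⟩
  choose w hw hb hE using hex
  exact ⟨sInf S, w, hw, hb, fun φ hφ => csInf_le hSb ⟨φ, hφ, rfl⟩, hE⟩

/-- Along a minimizing sequence that is Cauchy in `L¹` the gradients are Cauchy in `L^p`: the energy
of a midpoint is not smaller than the infimum, so the midpoint inequality for `‖·‖ ^ p` is almost an
equality. -/
theorem gradient_cauchy_of_minimizing (hp : 1 < p) (hlam : 0 ≤ lam) (hh : Continuous h)
    (hB : ∀ s, |h s| ≤ B) {m M : ℝ} (hM0 : 0 ≤ M) {w : ℕ → EuclideanSpace ℝ (Fin N) → ℝ}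
    (hw : ∀ k, IsTestFunction Ω (w k))
    (hm : ∀ φ, IsTestFunction Ω φ →
        m ≤ energy p lam (fun s => ∫ t in (0 : ℝ)..s, h t) Ω φ (gradient φ))
    (hE : Tendsto (fun k => energy p lam (fun s => ∫ t in (0 : ℝ)..s, h t) Ω (w k)
      (gradient (w k))) atTop (𝓝 m))
    (hM : ∀ k, ∫ x in Ω, ‖gradient (w k) x‖ ^ p ≤ M)
    (hc : ∀ ε > 0, ∃ K, ∀ k ≥ K, ∀ j ≥ K, ∫ x in Ω, |w k x - w j x| ≤ ε) :
    ∀ ε > 0, ∃ K, ∀ k ≥ K, ∀ j ≥ K, ∫ x in Ω, ‖gradient (w k) x - gradient (w j) x‖ ^ p ≤ ε := by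
  intro ε hε
  have hp0 : 0 < p := by linarith
  have hB0 : 0 ≤ B := (abs_nonneg _).trans (hB 0)
  have hHc := continuous_primitive_of_continuous hh
  obtain ⟨C, hC0, hC⟩ := exists_norm_sub_rpow_le_defect (E := EuclideanSpace ℝ (Fin N)) hp
    (show 0 < ε / (4 * (M + 1)) by positivity)
  set δ : ℝ := ε / (4 * (C * p + 1)) with hδ
  have hδ0 : 0 < δ := by positivity
  obtain ⟨K₁, hK₁⟩ := eventually_atTop.1 (hE.eventually_le_const (lt_add_of_pos_right m hδ0))
  obtain ⟨K₂, hK₂⟩ := hc (δ / (lam * (B / 2) + 1)) (by positivity)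
  refine ⟨max K₁ K₂, fun k hk j hj => ?_⟩
  have ek := hK₁ k (le_of_max_le_left hk)
  have ej := hK₁ j (le_of_max_le_left hj)
  have hl := hK₂ k (le_of_max_le_right hk) j (le_of_max_le_right hj)
  have hgk := (hw k).memLp_gradient (ENNReal.ofReal p)
  have hgj := (hw j).memLp_gradient (ENNReal.ofReal p)
  have hik := integrable_norm_rpow_of_memLp hp hgk
  have hij := integrable_norm_rpow_of_memLp hp hgj
  have him := integrable_norm_rpow_of_memLp hp ((hgk.add hgj).const_smul (1 / 2 : ℝ))
  have his := integrable_norm_rpow_of_memLp hp (hgk.sub hgj)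
  simp only [Pi.smul_apply, Pi.add_apply, Pi.sub_apply] at him his
  have hD : Integrable (fun x => (‖gradient (w k) x‖ ^ p + ‖gradient (w j) x‖ ^ p) / 2 -
      ‖(1 / 2 : ℝ) • (gradient (w k) x + gradient (w j) x)‖ ^ p) (volume.restrict Ω) :=
    ((hik.add hij).div_const 2).sub him
  have hsum : Integrable (fun x => ‖gradient (w k) x‖ ^ p + ‖gradient (w j) x‖ ^ p)
      (volume.restrict Ω) := hik.add hij
  have hdef := integral_defect_le_energy (lam := lam) hp hlam hHc intervalIntegral.integral_same
    (abs_primitive_sub_le hh hB) (((hw k).memLp 1).integrable le_rfl)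
    (((hw j).memLp 1).integrable le_rfl) hgk hgj
  have hmid := hm _ (((hw k).add (hw j)).const_mul (1 / 2))
  have hg : gradient (fun x => 1 / 2 * (w k x + w j x)) =
      fun x => (1 / 2 : ℝ) • (gradient (w k) x + gradient (w j) x) := by
    ext1 x
    rw [((hw k).add (hw j)).gradient_const_mul, (hw k).gradient_add (hw j)]
  rw [hg] at hmid
  have hsmall : lam * (B / 2 * ∫ x in Ω, |w k x - w j x|) ≤ δ := by
    rw [le_div_iff₀ (by positivity)] at hl
    have : 0 ≤ ∫ x in Ω, |w k x - w j x| := by positivity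
    nlinarith
  calc ∫ x in Ω, ‖gradient (w k) x - gradient (w j) x‖ ^ p
      ≤ ∫ x in Ω, (ε / (4 * (M + 1)) * (‖gradient (w k) x‖ ^ p + ‖gradient (w j) x‖ ^ p) +
          C * ((‖gradient (w k) x‖ ^ p + ‖gradient (w j) x‖ ^ p) / 2 -
            ‖(1 / 2 : ℝ) • (gradient (w k) x + gradient (w j) x)‖ ^ p)) :=
        integral_mono his ((hsum.const_mul _).add (hD.const_mul C)) fun x => hC _ _
    _ = ε / (4 * (M + 1)) * ((∫ x in Ω, ‖gradient (w k) x‖ ^ p) +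
          ∫ x in Ω, ‖gradient (w j) x‖ ^ p) +
        C * ∫ x in Ω, ((‖gradient (w k) x‖ ^ p + ‖gradient (w j) x‖ ^ p) / 2 -
            ‖(1 / 2 : ℝ) • (gradient (w k) x + gradient (w j) x)‖ ^ p) := by
        rw [integral_add (hsum.const_mul _) (hD.const_mul C), integral_const_mul,
          integral_const_mul, integral_add hik hij]
    _ ≤ ε / (4 * (M + 1)) * (M + M) + C * (p * (2 * δ)) := by
        gcongr
        · exact hM k
        · exact hM j
        · refine hdef.trans (mul_le_mul_of_nonneg_left ?_ hp0.le)
          linarith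
    _ ≤ ε / 2 + ε / 2 := by
        gcongr
        · rw [div_mul_eq_mul_div, div_le_iff₀ (by positivity)]
          nlinarith
        · rw [hδ]
          rw [show C * (p * (2 * (ε / (4 * (C * p + 1))))) = 2 * (C * p) * ε / (4 * (C * p + 1)) by
            ring, div_le_iff₀ (by positivity)]
          nlinarith
    _ = ε := by ring

/-- Existence of a minimizer of the energy: an element of `W_0^{1,p}` with values in `[0, α]` whose
energy does not exceed that of any test function. -/
theorem exists_minimizer (hΩm : MeasurableSet Ω) (hp : 1 < p) (hlam : 0 ≤ lam) (hh : Continuous h)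
    (hB : ∀ s, |h s| ≤ B) (hα : 0 < α) (hneg : ∀ s ≤ 0, 0 ≤ h s)
    (hbig : ∀ s, α ≤ s → h s = 0) :
    ∃ u G, MemSobolevZero p Ω u G ∧ (∀ᵐ x ∂(volume.restrict Ω), 0 ≤ u x ∧ u x ≤ α) ∧
      ∀ φ, IsTestFunction Ω φ → energy p lam (fun s => ∫ t in (0 : ℝ)..s, h t) Ω u G ≤
        energy p lam (fun s => ∫ t in (0 : ℝ)..s, h t) Ω φ (gradient φ) := by
  have hp0 : 0 < p := by linarith
  have hHc := continuous_primitive_of_continuous hh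
  obtain ⟨m, v, hv, hvb, hm, hvE⟩ := exists_minimizing_seq (Ω := Ω) hp hlam hh hB hα hneg hbig
  have hone : ∀ k : ℕ, 1 / (k + 1 : ℝ) ≤ 1 := fun k => by
    rw [div_le_one (by positivity)]
    linarith [k.cast_nonneg (α := ℝ)]
  obtain ⟨M, hM0, hM⟩ : ∃ M : ℝ, 0 ≤ M ∧ ∀ k, ∫ x in Ω, ‖gradient (v k) x‖ ^ p ≤ M := by
    have h1 : ∀ k, ∫ x in Ω, ‖gradient (v k) x‖ ^ p ≤
        p * (m + 1 + lam * (B * α * volume.real Ω)) := by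
      intro k
      refine (integral_norm_rpow_le_energy hp hlam
        (primitive_le_of_truncated hh hB hα hneg hbig)
        (integrable_comp_of_lipschitz hHc intervalIntegral.integral_same
          (abs_primitive_sub_le hh hB) (((hv k).memLp 1).integrable le_rfl))).trans ?_
      have := hvE k
      have := hone k
      gcongr
      linarith
    exact ⟨_, le_trans (by positivity) (h1 0), h1⟩
  have hvC : ∀ k x, |v k x| ≤ α + 1 := fun k x => by
    have h1 := hvb k x
    have h2 := hone k
    rw [abs_le]
    constructor <;> linarith
  have hgradL1 : ∀ k, ∫⁻ x, ‖fderiv ℝ (v k) x‖ₑ ≤ ENNReal.ofReal (volume.real Ω + M) := by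
    intro k
    have hgi := ((hv k).memLp_gradient 1).integrable le_rfl
    have h1 : ∫⁻ x, ‖fderiv ℝ (v k) x‖ₑ = ∫⁻ x in Ω, ‖gradient (v k) x‖ₑ := by
      rw [← lintegral_indicator hΩm]
      refine lintegral_congr fun x => ?_
      by_cases hx : x ∈ Ω
      · rw [indicator_of_mem hx, ← ofReal_norm, ← ofReal_norm, IsTestFunction.norm_gradient]
      · rw [indicator_of_notMem hx, ← ofReal_norm, ← IsTestFunction.norm_gradient,
          (hv k).gradient_eq_zero_of_notMem hx, norm_zero, ENNReal.ofReal_zero]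
    rw [h1, ← ofReal_integral_norm_eq_lintegral_enorm hgi]
    refine ENNReal.ofReal_le_ofReal ?_
    have hip := integrable_norm_rpow_of_memLp hp ((hv k).memLp_gradient _)
    calc ∫ x in Ω, ‖gradient (v k) x‖ ≤ ∫ x in Ω, (1 + ‖gradient (v k) x‖ ^ p) := by
          refine integral_mono hgi.norm ((integrable_const 1).add hip) fun x => ?_
          dsimp only
          rcases le_total ‖gradient (v k) x‖ 1 with h | h
          · have : 0 ≤ ‖gradient (v k) x‖ ^ p := by positivity
            linarith
          · have := Real.rpow_le_rpow_of_exponent_le h hp.le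
            rw [Real.rpow_one] at this
            linarith
      _ = volume.real Ω + ∫ x in Ω, ‖gradient (v k) x‖ ^ p := by
          rw [integral_add (integrable_const 1) hip]
          simp
      _ ≤ _ := by gcongr; exact hM k
  have hΩfin : volume Ω ≠ ⊤ := by
    simpa using measure_ne_top (volume.restrict Ω) univ
  obtain ⟨ns, hns, hcau⟩ := exists_subseq_integral_cauchy volume hΩm hΩfin
    (fun k => (hv k).contDiff.of_le (by simp)) (fun k x hx => (hv k).eq_zero_of_notMem hx) hvC
    ENNReal.ofReal_ne_top hgradL1
  have hinv : Tendsto (fun k => 1 / ((ns k : ℕ) + 1 : ℝ)) atTop (𝓝 0) :=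
    tendsto_one_div_add_atTop_nhds_zero_nat.comp hns.tendsto_atTop
  have hEm : Tendsto (fun k => energy p lam (fun s => ∫ t in (0 : ℝ)..s, h t) Ω (v (ns k))
      (gradient (v (ns k)))) atTop (𝓝 m) :=
    tendsto_of_tendsto_of_tendsto_of_le_of_le tendsto_const_nhds
      (by simpa using hinv.const_add m) (fun k => hm _ (hv _)) fun k => hvE _
  have hgc := gradient_cauchy_of_minimizing hp hlam hh hB hM0 (fun k => hv (ns k)) hm hEm
    (fun k => hM (ns k)) hcau
  -- for uniformly bounded functions, convergence in `L¹` gives convergence in `L^p`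
  have hfc : ∀ ε > 0, ∃ K, ∀ k ≥ K, ∀ j ≥ K,
      ∫ x in Ω, ‖v (ns k) x - v (ns j) x‖ ^ p ≤ ε := by
    intro ε hε
    set R : ℝ := (2 * (α + 1)) ^ (p - 1) with hR
    have hR0 : 0 < R := by positivity
    obtain ⟨K, hK⟩ := hcau (ε / R) (by positivity)
    refine ⟨K, fun k hk j hj => ?_⟩
    have h1 := hK k hk j hj
    have hi := (((hv (ns k)).memLp 1).sub ((hv (ns j)).memLp 1)).integrable le_rfl
    have hip := integrable_norm_rpow_of_memLp hp
      (((hv (ns k)).memLp (ENNReal.ofReal p)).sub ((hv (ns j)).memLp _))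
    simp only [Pi.sub_apply] at hip
    calc ∫ x in Ω, ‖v (ns k) x - v (ns j) x‖ ^ p ≤ ∫ x in Ω, R * |v (ns k) x - v (ns j) x| := by
          refine integral_mono hip (hi.abs.const_mul R) fun x => ?_
          simp only [Real.norm_eq_abs]
          rcases eq_or_ne (v (ns k) x - v (ns j) x) 0 with h0 | h0
          · simp [h0, Real.zero_rpow hp0.ne']
          · rw [show p = (p - 1) + 1 by ring, Real.rpow_add_one (abs_pos.2 h0).ne']
            gcongr
            rw [hR]
            refine Real.rpow_le_rpow (abs_nonneg _) ?_ (by linarith)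
            have := hvC (ns k) x
            have := hvC (ns j) x
            exact (abs_sub _ _).trans (by linarith)
      _ = R * ∫ x in Ω, |v (ns k) x - v (ns j) x| := integral_const_mul _ _
      _ ≤ R * (ε / R) := by gcongr
      _ = ε := by field_simp
  obtain ⟨u, huL, hwu⟩ := exists_memLp_tendsto_of_integral_cauchy hp
    (fun k => (hv (ns k)).memLp (ENNReal.ofReal p)) hfc
  obtain ⟨G, hGL, hgG⟩ := exists_memLp_tendsto_of_integral_cauchy hp
    (fun k => (hv (ns k)).memLp_gradient (ENNReal.ofReal p)) hgc
  refine ⟨u, G, memSobolevZero_of_tendsto hp (fun k => hv (ns k)) huL hGL hwu hgG, ?_, ?_⟩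
  · obtain ⟨ks, hks, hae⟩ := (tendstoInMeasure_of_tendsto_eLpNorm (by simpa using hp0)
      (fun k => ((hv (ns k)).memLp (ENNReal.ofReal p)).1) huL.1 hwu).exists_seq_tendsto_ae
    filter_upwards [hae] with x hx
    have hinv' := hinv.comp hks.tendsto_atTop
    constructor
    · have h1 := hinv'.neg
      rw [neg_zero] at h1
      exact le_of_tendsto_of_tendsto' h1 hx fun k => (hvb _ x).1
    · have h1 := hinv'.const_add α
      rw [add_zero] at h1
      exact le_of_tendsto_of_tendsto' hx h1 fun k => (hvb _ x).2
  · intro φ hφ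
    have h1 := tendsto_energy (lam := lam) hp hHc intervalIntegral.integral_same
      (abs_primitive_sub_le hh hB) (fun k => (hv (ns k)).memLp _) huL
      (fun k => (hv (ns k)).memLp_gradient _) hGL hwu hgG
    rw [tendsto_nhds_unique h1 hEm]
    exact hm φ hφ

end Existence

/-! ### Solutions below a zero of the nonlinearity -/

section Solutions

variable {N : ℕ} {Ω : Set (EuclideanSpace ℝ (Fin N))} [IsFiniteMeasure (volume.restrict Ω)]
  {p lam : ℝ} {f : ℝ → ℝ} {α : ℝ}

/-- Below every positive zero `α` of `f` there is a solution with values in `[0, α]` whose energy does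
not exceed that of any test function with values in `[0, α]`. It minimizes the energy associated with
the bounded nonlinearity that agrees with `f` on `[0, α]` and is constant on either side; the sign
conditions `0 ≤ f 0` and `f α = 0` make the truncation harmless. -/
theorem exists_solution_le_zero_of_nonlinearity (hΩm : MeasurableSet Ω) (hp : 1 < p)
    (hlam : 0 ≤ lam) (hf : Continuous f) (hf0 : 0 ≤ f 0) (hα : 0 < α) (hfα : f α = 0) :
    ∃ u, IsBoundedWeakSolution p Ω lam f u ∧
      (∀ᵐ x ∂(volume.restrict Ω), 0 ≤ u x ∧ u x ≤ α) ∧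
      ∀ φ, IsTestFunction Ω φ → (∀ x, 0 ≤ φ x ∧ φ x ≤ α) →
        -(lam * ∫ x in Ω, ∫ t in (0 : ℝ)..u x, f t) ≤
          energy p lam (fun s => ∫ t in (0 : ℝ)..s, f t) Ω φ (gradient φ) := by
  let h : ℝ → ℝ := fun s => f (max 0 (min s α))
  have hh : Continuous h := hf.comp (by fun_prop)
  have heq : ∀ s, 0 ≤ s ∧ s ≤ α → h s = f s := fun s hs => by simp [h, hs.1, hs.2]
  obtain ⟨B, hB⟩ : ∃ B, ∀ s, |h s| ≤ B := by
    obtain ⟨B, hB⟩ := (isCompact_Icc (a := (0 : ℝ)) (b := α)).exists_bound_of_continuousOn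
      hf.continuousOn
    exact ⟨B, fun s => hB _ ⟨le_max_left _ _, max_le hα.le (min_le_right _ _)⟩⟩
  have hneg : ∀ s ≤ 0, 0 ≤ h s := fun s hs => by simpa [h, hs, hs.trans hα.le] using hf0
  have hbig : ∀ s, α ≤ s → h s = 0 := fun s hs => by simpa [h, hs, hα.le] using hfα
  have hprim : ∀ s, 0 ≤ s ∧ s ≤ α → ∫ t in (0 : ℝ)..s, h t = ∫ t in (0 : ℝ)..s, f t := by
    intro s hs
    refine intervalIntegral.integral_congr fun t ht => heq t ?_
    rw [uIcc_of_le hs.1] at ht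
    exact ⟨ht.1, ht.2.trans hs.2⟩
  obtain ⟨u, G, huG, hub, hmin⟩ := exists_minimizer hΩm hp hlam hh hB hα hneg hbig
  refine ⟨u, ⟨?_, G, huG, fun φ hφ => ?_⟩, hub, fun φ hφ hφb => ?_⟩
  · refine MemLp.of_bound huG.memSobolev.memLp.1 α ?_
    filter_upwards [hub] with x hx
    rw [Real.norm_of_nonneg hx.1]
    exact hx.2
  · rw [euler_lagrange hp hh hB huG hmin hφ]
    congr 1
    refine integral_congr_ae ?_
    filter_upwards [hub] with x hx
    rw [heq _ hx]
  · have h1 := hmin φ hφ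
    have h2 : ∫ x in Ω, ∫ t in (0 : ℝ)..u x, h t = ∫ x in Ω, ∫ t in (0 : ℝ)..u x, f t := by
      refine integral_congr_ae ?_
      filter_upwards [hub] with x hx
      exact hprim _ hx
    have h3 : ∫ x in Ω, ∫ t in (0 : ℝ)..φ x, h t = ∫ x in Ω, ∫ t in (0 : ℝ)..φ x, f t :=
      integral_congr_ae (Eventually.of_forall fun x => hprim _ (hφb x))
    simp only [energy, h2, h3] at h1 ⊢
    have h4 : 0 ≤ 1 / p * ∫ x in Ω, ‖G x‖ ^ p := by
      have : 0 < p := by linarith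
      positivity
    linarith

omit [IsFiniteMeasure (volume.restrict Ω)] in
theorem exists_cutoff (hΩo : IsOpen Ω) {K : Set (EuclideanSpace ℝ (Fin N))} (hK : IsCompact K)
    (hKΩ : K ⊆ Ω) :
    ∃ ψ, IsTestFunction Ω ψ ∧ (∀ x, 0 ≤ ψ x ∧ ψ x ≤ 1) ∧ ∀ x ∈ K, ψ x = 1 := by
  obtain ⟨K', hK', hKK', hK'Ω⟩ := exists_compact_between hK hΩo hKΩ
  obtain ⟨ψ, h0, h1, hb⟩ := exists_contMDiffMap_zero_one_of_isClosed
    (modelWithCornersSelf ℝ (EuclideanSpace ℝ (Fin N))) (n := ⊤)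
    (isOpen_interior (s := K')).isClosed_compl hK.isClosed
    (disjoint_compl_left_iff_subset.2 hKK')
  have hsupp : tsupport ψ ⊆ K' := by
    refine closure_minimal (fun x hx => ?_) hK'.isClosed
    by_contra hxK
    exact hx (h0 fun h => hxK (interior_subset h))
  exact ⟨ψ, ⟨ψ.contMDiff.contDiff, hK'.of_isClosed_subset (isClosed_tsupport _) hsupp,
    hsupp.trans hK'Ω⟩, fun x => hb x, fun x hx => h1 hx⟩

/-- The energy of a multiple of a cutoff function that equals `1` on `K`: on `K` the primitive takes the
value at the height `s`, and elsewhere only the lower bound `-(C t ^ p + D)` is available. -/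
theorem energy_smul_cutoff_le (hΩm : MeasurableSet Ω) (hp : 1 < p) (hlam : 0 ≤ lam)
    (hf : Continuous f) {K : Set (EuclideanSpace ℝ (Fin N))} (hK : IsCompact K) (hKΩ : K ⊆ Ω)
    {ψ : EuclideanSpace ℝ (Fin N) → ℝ} (hψ : IsTestFunction Ω ψ) (hψb : ∀ x, 0 ≤ ψ x ∧ ψ x ≤ 1)
    (hψK : ∀ x ∈ K, ψ x = 1) {C D s : ℝ} (hC : 0 ≤ C) (hs : 0 < s)
    (hlow : ∀ t, 0 ≤ t → t ≤ s → -(C * t ^ p + D) ≤ ∫ r in (0 : ℝ)..t, f r) :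
    energy p lam (fun s => ∫ t in (0 : ℝ)..s, f t) Ω (fun x => s * ψ x)
        (gradient fun x => s * ψ x) ≤
      s ^ p * (1 / p * ∫ x in Ω, ‖gradient ψ x‖ ^ p) -
        lam * ((∫ r in (0 : ℝ)..s, f r) * volume.real K -
          (C * s ^ p + D) * volume.real (Ω \ K)) := by
  have hp0 : 0 < p := by linarith
  have hFc := continuous_primitive_of_continuous hf
  have hfin : volume Ω ≠ ⊤ := by simpa using measure_ne_top (volume.restrict Ω) univ
  have hKm := hK.measurableSet
  have hfinK : volume K ≠ ⊤ := ne_top_of_le_ne_top hfin (measure_mono hKΩ)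
  have hfinD : volume (Ω \ K) ≠ ⊤ := ne_top_of_le_ne_top hfin (measure_mono sdiff_subset)
  have hsψ : ∀ x, 0 ≤ s * ψ x ∧ s * ψ x ≤ s := fun x =>
    ⟨mul_nonneg hs.le (hψb x).1, mul_le_of_le_one_right hs.le (hψb x).2⟩
  have hgrad : ∫ x in Ω, ‖gradient (fun x => s * ψ x) x‖ ^ p =
      s ^ p * ∫ x in Ω, ‖gradient ψ x‖ ^ p := by
    rw [← integral_const_mul]
    refine integral_congr_ae (Eventually.of_forall fun x => ?_)
    dsimp only
    rw [hψ.gradient_const_mul, norm_smul, Real.norm_of_nonneg hs.le,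
      Real.mul_rpow hs.le (norm_nonneg _)]
  have hint : IntegrableOn (fun x => ∫ t in (0 : ℝ)..(s * ψ x), f t) Ω := by
    obtain ⟨b, hb⟩ := (isCompact_Icc (a := (0 : ℝ)) (b := s)).exists_bound_of_continuousOn
      hFc.continuousOn
    exact Integrable.of_bound (hFc.comp (hψ.continuous.const_mul s)).aestronglyMeasurable b
      (Eventually.of_forall fun x => hb _ (hsψ x))
  have hF : (∫ r in (0 : ℝ)..s, f r) * volume.real K - (C * s ^ p + D) * volume.real (Ω \ K) ≤
      ∫ x in Ω, ∫ t in (0 : ℝ)..(s * ψ x), f t := by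
    have hsplit := integral_inter_add_sdiff hKm hint
    rw [inter_eq_self_of_subset_right hKΩ] at hsplit
    have h1 : ∫ x in K, ∫ t in (0 : ℝ)..(s * ψ x), f t =
        (∫ r in (0 : ℝ)..s, f r) * volume.real K := by
      rw [setIntegral_congr_fun (g := fun _ => ∫ r in (0 : ℝ)..s, f r) hKm fun x hx => by
        simp only [hψK x hx, mul_one]]
      rw [setIntegral_const, smul_eq_mul, mul_comm]
    have h2 : -(C * s ^ p + D) * volume.real (Ω \ K) ≤
        ∫ x in Ω \ K, ∫ t in (0 : ℝ)..(s * ψ x), f t := by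
      have h3 := setIntegral_mono_on (μ := volume) (f := fun _ => -(C * s ^ p + D))
        (integrableOn_const hfinD) (hint.mono_set sdiff_subset) (hΩm.diff hKm) fun x _ => by
          refine le_trans ?_ (hlow _ (hsψ x).1 (hsψ x).2)
          have := Real.rpow_le_rpow (hsψ x).1 (hsψ x).2 hp0.le
          nlinarith
      rwa [setIntegral_const, smul_eq_mul, mul_comm] at h3
    linarith
  have := mul_le_mul_of_nonneg_left hF hlam
  simp only [energy, hgrad]
  rw [mul_left_comm]
  linarith

end Solutions

/-! ### Multiplicity for a fixed parameter -/

section Multiplicity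

variable {N : ℕ} {Ω : Set (EuclideanSpace ℝ (Fin N))} [IsFiniteMeasure (volume.restrict Ω)]
  {p lam : ℝ} {f : ℝ → ℝ} {K : Set (EuclideanSpace ℝ (Fin N))}
  {ψ : EuclideanSpace ℝ (Fin N) → ℝ} {C m : ℝ} {α : ℕ → ℝ}

theorem mul_rpow_lt_of_lt_div_rpow {F s : ℝ} (hs : 0 < s) (h : m < F / s ^ p) : m * s ^ p < F :=
  (lt_div_iff₀ (by positivity)).1 h

/-- Small solutions. For small heights `s` the energy of `s ψ` is negative, so the minimizers are not
trivial. -/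
theorem exists_solutions_tendsto_zero (hΩm : MeasurableSet Ω) (hp : 1 < p) (hlam : 0 < lam)
    (hf : Continuous f) (hf0 : 0 ≤ f 0) (hα : ∀ n, 0 < α n) (hαt : Tendsto α atTop (𝓝[>] 0))
    (hfα : ∀ n, f (α n) = 0) (hK : IsCompact K) (hKΩ : K ⊆ Ω)
    (hψ : IsTestFunction Ω ψ) (hψb : ∀ x, 0 ≤ ψ x ∧ ψ x ≤ 1)
    (hψK : ∀ x ∈ K, ψ x = 1) (hC : 0 ≤ C)
    (hlow : ∀ᶠ s in 𝓝[>] (0 : ℝ), -C ≤ (∫ t in (0 : ℝ)..s, f t) / s ^ p)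
    (hfreq : ∃ᶠ s in 𝓝[>] (0 : ℝ), m < (∫ t in (0 : ℝ)..s, f t) / s ^ p)
    (hlarge : 1 / p * (∫ x in Ω, ‖gradient ψ x‖ ^ p) <
      lam * (m * volume.real K - C * volume.real (Ω \ K))) :
    ∃ u : ℕ → EuclideanSpace ℝ (Fin N) → ℝ,
      (∀ n, IsBoundedWeakSolution p Ω lam f (u n) ∧
        (∀ᵐ x ∂(volume.restrict Ω), 0 ≤ u n x) ∧
        ¬ (∀ᵐ x ∂(volume.restrict Ω), u n x = 0)) ∧
      Tendsto (fun n => eLpNorm (u n) ⊤ (volume.restrict Ω)) atTop (𝓝 0) := by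
  have hp0 : 0 < p := by linarith
  choose u hu hub hue using fun n =>
    exists_solution_le_zero_of_nonlinearity (Ω := Ω) hΩm hp hlam.le hf hf0 (hα n) (hfα n)
  refine ⟨u, fun n => ⟨hu n, (hub n).mono fun x hx => hx.1, fun h0 => ?_⟩, ?_⟩
  · obtain ⟨r, hr, hrlow⟩ := (mem_nhdsGT_iff_exists_Ioo_subset).1 hlow
    obtain ⟨s, hsm, hs0, hsr⟩ := (hfreq.and_eventually
      (Ioo_mem_nhdsGT (lt_min hr (hα n)))).exists
    have hsr1 := hsr.trans_le (min_le_left _ _)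
    have hsα := hsr.trans_le (min_le_right _ _)
    have hb := energy_smul_cutoff_le (lam := lam) (D := 0) hΩm hp hlam.le hf hK hKΩ hψ hψb hψK hC hs0
      fun t ht0 hts => by
        rcases ht0.eq_or_lt with rfl | ht0
        · simp [Real.zero_rpow hp0.ne']
        · have h1 : -C ≤ _ := hrlow ⟨ht0, hts.trans_lt hsr1⟩
          rw [le_div_iff₀ (by positivity)] at h1
          linarith
    have hge := hue n _ (hψ.const_mul s) fun x =>
      ⟨mul_nonneg hs0.le (hψb x).1, (mul_le_of_le_one_right hs0.le (hψb x).2).trans hsα.le⟩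
    have hzero : ∫ x in Ω, ∫ t in (0 : ℝ)..u n x, f t = 0 := by
      rw [integral_congr_ae (g := fun _ => (0 : ℝ))]
      · simp
      · filter_upwards [h0] with x hx
        rw [hx, intervalIntegral.integral_same]
    rw [hzero] at hge
    have hFs := mul_le_mul_of_nonneg_right (mul_rpow_lt_of_lt_div_rpow hs0 hsm).le
      (measureReal_nonneg (μ := volume) (s := K))
    have hFs' := mul_le_mul_of_nonneg_left hFs hlam.le
    have hneg := mul_lt_mul_of_pos_left hlarge (Real.rpow_pos_of_pos hs0 p)
    nlinarith
  · have h1 : Tendsto (fun n => ENNReal.ofReal (α n)) atTop (𝓝 0) := by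
      have := ENNReal.tendsto_ofReal (hαt.mono_right nhdsWithin_le_nhds)
      rwa [ENNReal.ofReal_zero] at this
    refine tendsto_of_tendsto_of_tendsto_of_le_of_le tendsto_const_nhds h1 (fun _ => zero_le)
      fun n => ?_
    rw [eLpNorm_exponent_top]
    refine eLpNormEssSup_le_of_ae_bound ?_
    filter_upwards [hub n] with x hx
    rw [Real.norm_of_nonneg hx.1]
    exact hx.2

/-- Large solutions. The energy of `s ψ` tends to `-∞` along suitable heights `s`, hence so do the minimal
energies, which is impossible for solutions that stay bounded. -/
theorem exists_solutions_tendsto_top (hΩm : MeasurableSet Ω) (hp : 1 < p) (hlam : 0 < lam)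
    (hf : Continuous f) (hf0 : 0 ≤ f 0) (hα : ∀ n, 0 < α n) (hαt : Tendsto α atTop atTop)
    (hfα : ∀ n, f (α n) = 0) (hK : IsCompact K) (hKΩ : K ⊆ Ω)
    (hψ : IsTestFunction Ω ψ) (hψb : ∀ x, 0 ≤ ψ x ∧ ψ x ≤ 1)
    (hψK : ∀ x ∈ K, ψ x = 1) (hC : 0 ≤ C)
    (hlow : ∀ᶠ s in atTop, -C ≤ (∫ t in (0 : ℝ)..s, f t) / s ^ p)
    (hfreq : ∃ᶠ s in atTop, m < (∫ t in (0 : ℝ)..s, f t) / s ^ p)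
    (hlarge : 1 / p * (∫ x in Ω, ‖gradient ψ x‖ ^ p) <
      lam * (m * volume.real K - C * volume.real (Ω \ K))) :
    ∃ u : ℕ → EuclideanSpace ℝ (Fin N) → ℝ,
      (∀ n, IsBoundedWeakSolution p Ω lam f (u n) ∧
        (∀ᵐ x ∂(volume.restrict Ω), 0 ≤ u n x) ∧
        ¬ (∀ᵐ x ∂(volume.restrict Ω), u n x = 0)) ∧
      Tendsto (fun n => eLpNorm (u n) ⊤ (volume.restrict Ω)) atTop (𝓝 ⊤) := by
  have hp0 : 0 < p := by linarith
  have hFc := continuous_primitive_of_continuous hf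
  choose u hu hub hue using fun n =>
    exists_solution_le_zero_of_nonlinearity (Ω := Ω) hΩm hp hlam.le hf hf0 (hα n) (hfα n)
  obtain ⟨D, hD⟩ : ∃ D : ℝ, ∀ t, 0 ≤ t → -(C * t ^ p + D) ≤ ∫ r in (0 : ℝ)..t, f r := by
    obtain ⟨R, hR⟩ := eventually_atTop.1 (hlow.and (eventually_gt_atTop 0))
    obtain ⟨b, hb⟩ := (isCompact_Icc (a := (0 : ℝ)) (b := R)).exists_bound_of_continuousOn
      hFc.continuousOn
    refine ⟨max b 0, fun t ht => ?_⟩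
    have hCt : 0 ≤ C * t ^ p := by positivity
    rcases le_total t R with htR | htR
    · have h1 := (abs_le.1 (hb t ⟨ht, htR⟩)).1
      linarith [le_max_left b 0]
    · obtain ⟨h1, h2⟩ := hR t htR
      rw [le_div_iff₀ (by positivity)] at h1
      linarith [le_max_right b 0]
  have hunb : ∀ M : ℝ, ∀ᶠ n in atTop, ¬ ∀ᵐ x ∂(volume.restrict Ω), u n x ≤ M := by
    intro M
    obtain ⟨b, hb⟩ := (isCompact_Icc (a := (0 : ℝ)) (b := M)).exists_bound_of_continuousOn
      hFc.continuousOn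
    set e := lam * (m * volume.real K - C * volume.real (Ω \ K)) -
      1 / p * (∫ x in Ω, ‖gradient ψ x‖ ^ p) with he
    have he0 : 0 < e := sub_pos.2 hlarge
    have hbig : ∀ᶠ s in atTop, lam * (D * volume.real (Ω \ K)) + lam * (b * volume.real Ω) <
        s ^ p * e :=
      ((tendsto_rpow_atTop hp0).atTop_mul_const he0).eventually_gt_atTop _
    obtain ⟨s, hsm, hsb, hs0⟩ := (hfreq.and_eventually (hbig.and (eventually_gt_atTop 0))).exists
    filter_upwards [hαt.eventually_ge_atTop s] with n hn hle
    have hub' := energy_smul_cutoff_le (lam := lam) hΩm hp hlam.le hf hK hKΩ hψ hψb hψK hC hs0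
      fun t ht0 _ => hD t ht0
    have hge := hue n _ (hψ.const_mul s) fun x =>
      ⟨mul_nonneg hs0.le (hψb x).1, (mul_le_of_le_one_right hs0.le (hψb x).2).trans hn⟩
    have hFu : ∫ x in Ω, ∫ t in (0 : ℝ)..u n x, f t ≤ b * volume.real Ω := by
      have hbd : ∀ᵐ x ∂(volume.restrict Ω), ‖∫ t in (0 : ℝ)..u n x, f t‖ ≤ b := by
        filter_upwards [hub n, hle] with x hx hxM
        exact hb _ ⟨hx.1, hxM⟩
      refine (le_abs_self _).trans ((norm_integral_le_of_norm_le_const hbd).trans_eq ?_)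
      simp
    have hFu' := mul_le_mul_of_nonneg_left hFu hlam.le
    have hFs := mul_le_mul_of_nonneg_right (mul_rpow_lt_of_lt_div_rpow hs0 hsm).le
      (measureReal_nonneg (μ := volume) (s := K))
    have hFs' := mul_le_mul_of_nonneg_left hFs hlam.le
    rw [he] at hsb
    nlinarith
  obtain ⟨n₀, hn₀⟩ := eventually_atTop.1 (hunb 0)
  refine ⟨fun n => u (n + n₀), fun n => ⟨hu _, (hub _).mono fun x hx => hx.1, fun h0 => ?_⟩, ?_⟩
  · exact hn₀ (n + n₀) (Nat.le_add_left _ _) (h0.mono fun x hx => hx.le)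
  · refine Tendsto.comp (g := fun n => eLpNorm (u n) ⊤ (volume.restrict Ω)) ?_
      (tendsto_add_atTop_nat n₀)
    rw [ENNReal.tendsto_nhds_top_iff_nnreal]
    intro M
    filter_upwards [hunb M] with n hn
    by_contra hlt
    refine hn ?_
    rw [not_lt, eLpNorm_exponent_top] at hlt
    filter_upwards [ae_le_eLpNormEssSup (f := u n) (μ := volume.restrict Ω)] with x hx
    have h1 := hx.trans hlt
    rw [← ofReal_norm, ENNReal.ofReal_le_coe] at h1
    exact (le_abs_self _).trans h1

end Multiplicity

/-! ### Choice of the cutoff and of the threshold for the parameter -/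

theorem theorem1p1 {N : ℕ} (hN : 1 ≤ N) (Ω : Set (EuclideanSpace ℝ (Fin N)))
    (hΩo : IsOpen Ω) (hΩb : Bornology.IsBounded Ω) (hΩne : Ω.Nonempty)
    (p : ℝ) (hp : 1 < p) (ℓ : ℝ≥0∞) (hℓ : ℓ = 0 ∨ ℓ = ⊤)
    (f : ℝ → ℝ) (hf : Continuous f) (hf0 : 0 ≤ f 0)
    (hzeros : ∃ α : ℕ → ℝ, (∀ n, 0 < α n) ∧ Tendsto α atTop (limitFilter ℓ) ∧ ∀ n, f (α n) = 0)
    (hliminf : ⊥ < liminf (fun s => primitiveQuotient f p s) (limitFilter ℓ))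
    (L : EReal) (hlimsup : limsup (fun s => primitiveQuotient f p s) (limitFilter ℓ) = L)
    (hL : 0 < L) :
    ∃ lamBar : ℝ, 0 ≤ lamBar ∧
      (∀ lam : ℝ, lamBar < lam →
        ∃ u : ℕ → EuclideanSpace ℝ (Fin N) → ℝ,
          (∀ n, IsBoundedWeakSolution p Ω lam f (u n) ∧
            (∀ᵐ x ∂(volume.restrict Ω), 0 ≤ u n x) ∧
            ¬ (∀ᵐ x ∂(volume.restrict Ω), u n x = 0)) ∧
          Tendsto (fun n => eLpNorm (u n) ⊤ (volume.restrict Ω)) atTop (𝓝 ℓ)) ∧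
      (L = ⊤ → lamBar = 0) := by
  have hp0 : 0 < p := by linarith
  have hΩm := hΩo.measurableSet
  have hfin : volume Ω ≠ ⊤ := hΩb.measure_lt_top.ne
  have : IsFiniteMeasure (volume.restrict Ω) := ⟨by simpa using hfin.lt_top⟩
  have hΩpos : 0 < volume.real Ω := ENNReal.toReal_pos (hΩo.measure_pos volume hΩne).ne' hfin
  obtain ⟨α, hα, hαt, hfα⟩ := hzeros
  obtain ⟨C, hC, hlow⟩ : ∃ C : ℝ, 0 ≤ C ∧
      ∀ᶠ s in limitFilter ℓ, -C ≤ (∫ t in (0 : ℝ)..s, f t) / s ^ p := by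
    obtain ⟨c, -, hc⟩ := EReal.lt_iff_exists_real_btwn.1 hliminf
    refine ⟨max (-c) 0, le_max_right _ _, ?_⟩
    filter_upwards [eventually_lt_of_lt_liminf hc] with s hs
    have h1 : c < (∫ t in (0 : ℝ)..s, f t) / s ^ p := EReal.coe_lt_coe_iff.1 hs
    linarith [le_max_left (-c) 0]
  have hfreq : ∀ m : ℝ, (m : EReal) < L →
      ∃ᶠ s in limitFilter ℓ, m < (∫ t in (0 : ℝ)..s, f t) / s ^ p := by
    intro m hm
    rw [← hlimsup] at hm
    exact (frequently_lt_of_lt_limsup (by isBoundedDefault) hm).mono fun s hs =>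
      EReal.coe_lt_coe_iff.1 hs
  obtain ⟨m₀, hm₀, hm₀L⟩ := EReal.lt_iff_exists_real_btwn.1 hL
  have hm₀pos : 0 < m₀ := EReal.coe_pos.1 hm₀
  -- the compact set on which the cutoff equals `1` must nearly exhaust `Ω`
  obtain ⟨K, hKΩ, hK, hKlt⟩ := hΩo.exists_lt_isCompact (μ := volume)
    (r := ENNReal.ofReal (C * volume.real Ω / (m₀ + C))) (by
      rw [← ofReal_measureReal hfin]
      refine (ENNReal.ofReal_lt_ofReal_iff hΩpos).2 ?_
      rw [div_lt_iff₀ (by positivity)]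
      nlinarith)
  have hKfin : volume K ≠ ⊤ := hK.measure_lt_top.ne
  have hKr : C * volume.real Ω / (m₀ + C) < volume.real K :=
    (ENNReal.ofReal_lt_iff_lt_toReal (by positivity) hKfin).1 hKlt
  have hKpos : 0 < volume.real K := lt_of_le_of_lt (by positivity) hKr
  have hdiff : volume.real (Ω \ K) = volume.real Ω - volume.real K :=
    measureReal_sdiff hKΩ hK.measurableSet
  have hc : 0 < m₀ * volume.real K - C * volume.real (Ω \ K) := by
    rw [div_lt_iff₀ (by positivity)] at hKr
    rw [hdiff]
    linarith
  obtain ⟨ψ, hψ, hψb, hψK⟩ := exists_cutoff hΩo hK hKΩ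
  set A := 1 / p * ∫ x in Ω, ‖gradient ψ x‖ ^ p with hA
  have hA0 : 0 ≤ A := by positivity
  have main : ∀ (lam m : ℝ), 0 < lam → (m : EReal) < L →
      A < lam * (m * volume.real K - C * volume.real (Ω \ K)) →
        ∃ u : ℕ → EuclideanSpace ℝ (Fin N) → ℝ,
          (∀ n, IsBoundedWeakSolution p Ω lam f (u n) ∧
            (∀ᵐ x ∂(volume.restrict Ω), 0 ≤ u n x) ∧
            ¬ (∀ᵐ x ∂(volume.restrict Ω), u n x = 0)) ∧
          Tendsto (fun n => eLpNorm (u n) ⊤ (volume.restrict Ω)) atTop (𝓝 ℓ) := by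
    intro lam m hlam hm hlarge
    have hfr := hfreq m hm
    rcases hℓ with rfl | rfl
    · rw [show limitFilter 0 = 𝓝[>] (0 : ℝ) by simp [limitFilter]] at hαt hlow hfr
      exact exists_solutions_tendsto_zero hΩm hp hlam hf hf0 hα hαt hfα hK hKΩ hψ hψb hψK hC hlow hfr
        hlarge
    · rw [show limitFilter ⊤ = (atTop : Filter ℝ) by simp [limitFilter]] at hαt hlow hfr
      exact exists_solutions_tendsto_top hΩm hp hlam hf hf0 hα hαt hfα hK hKΩ hψ hψb hψK hC hlow hfr
        hlarge
  by_cases hLtop : L = ⊤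
  · refine ⟨0, le_rfl, fun lam hlam => ?_, fun _ => rfl⟩
    -- every slope `m` is admissible here; this one solves `lam (m |K| - C |Ω \ K|) = A + lam`
    refine main lam ((A / lam + C * volume.real (Ω \ K) + 1) / volume.real K) hlam
      (hLtop ▸ EReal.coe_lt_top _) ?_
    rw [div_mul_cancel₀ _ hKpos.ne']
    have : lam * (A / lam + C * volume.real (Ω \ K) + 1 - C * volume.real (Ω \ K)) = A + lam := by
      field_simp
      ring
    linarith
  · refine ⟨A / (m₀ * volume.real K - C * volume.real (Ω \ K)), by positivity, fun lam hlam => ?_,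
      fun h => absurd h hLtop⟩
    refine main lam m₀ (lt_of_le_of_lt (by positivity) hlam) hm₀L ?_
    rwa [div_lt_iff₀ hc] at hlam
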